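/- All systems are finite-dimensional. A bipartite state is a density matrix (positive semidefinite, trace one) on $\mathcal H_A\otimes\mathcal H_B$, with $A$ held by Alice and $B$ by Bob; tensor products of bipartite states are again regarded as bipartite by grouping all of Alice's systems and all of Bob's systems. An LOCC protocol is a finite-round protocol of local operations and classical communication between Alice and Bob: in each round one party performs a measurement, given by finitely many Kraus operators $K_i$ with $\sum_i K_i^\dagger K_i=\mathbb 1$, on its own system and announces the outcome, on which all later rounds may depend; the outcomes are forgotten at the end. Let $\|M\|_1=\mathrm{Tr}\sqrt{M^\dagger M}$. Let $\rho$ be a state of a bipartite system and $\sigma$ a state of a (possibly different) bipartite system $S$, and let $r\in\mathbb R$. Below, $m\ge 0$ and $n\ge 1$ are integers, and $S_1,\dots,S_m$ are copies of $S$; a superscript on a state denotes the reduced state on the indicated systems. - An asymptotic transformation from $\rho$ to $\sigma$ is possible at rate $r$ if for all $\varepsilon,\delta>0$ there are $m,n$ and an LOCC protocol $\Lambda$ with $\|\Lambda(\rho^{\otimes n})-\sigma^{\otimes m}\|_1<\varepsilon$ and $\frac mn+\delta>r$. The supremum of such $r$ is the transformation rate $R(\rho\to\sigma)$. - A marginal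 asymptotic transformation from $\rho$ to $\sigma$ is possible at rate $r$ if for all $\varepsilon,\delta>0$ there are $m,n$ and an LOCC protocol $\Lambda$ such that $\mu^{S_1\ldots S_m}=\Lambda(\rho^{\otimes n})$ satisfies $\|\mu^{S_i}-\sigma\|_1<\varepsilon$ for all $i\le m$, and $\frac mn+\delta>r$. The supremum of such $r$ is the marginal transformation rate $R_{\mathrm m}(\rho\to\sigma)$. - A marginal asymptotic transformation with correlated catalysis from $\rho$ to $\sigma$ is possible at rate $r$ if for all $\varepsilon,\delta>0$ there are $m,n$, a bipartite state $\tau^C$ of some bipartite system $C$ (the catalyst) and an LOCC protocol $\Lambda$ such that $\mu^{S_1\ldots S_mC}=\Lambda(\rho^{\otimes n}\otimes\tau^C)$ satisfies $\|\mu^{S_i}-\sigma\|_1<\varepsilon$ for all $i\le m$, $\mu^C=\tau^C$, and $\frac mn+\delta>r$. The supremum of such $r$ is the marginal catalytic transformation rate $R_{\mathrm{mc}}(\rho\to\sigma)$. Suprema are taken in $[-\infty,\infty]$. A bipartite state $\rho$ is called distillable if $R(\rho\to\psi^-)>0$, where $\psi^-$ is the singlet, i.e. the pure two-qubit state $(|01\rangle-|10\rangle)/\sqrt2$.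 **Proposition.** For any two bipartite distillable states $\rho$ and $\sigma$, $$R_{\mathrm{mc}}(\rho\to\sigma)=R_{\mathrm m}(\rho\to\sigma).$$ -/

import Mathlib

open scoped Matrix Kronecker ComplexOrder

noncomputable section

namespace LOCCRates

/-- The trace norm `‖M‖₁ = Tr √(Mᴴ M)`, i.e. the sum of the square roots of the eigenvalues
of `Mᴴ M` (counted with multiplicity). -/
def traceNorm {I : Type} [Fintype I] [DecidableEq I] (M : Matrix I I ℂ) : ℝ :=
  ∑ i, Real.sqrt ((Matrix.isHermitian_conjTranspose_mul_self M).eigenvalues i)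

/-- Density matrices. The index type labels an orthonormal basis; a bipartite state, with
Alice holding a system with basis `A` and Bob one with basis `B`, is indexed by `A × B`. -/
def IsState {I : Type} [Fintype I] (ρ : Matrix I I ℂ) : Prop :=
  ρ.PosSemidef ∧ ρ.trace = 1

/-- `IsLOCC Λ`: the map `Λ` is implemented by a protocol of local operations and classical
communication with finitely many rounds. A protocol is a finite tree: in each round one party
performs a measurement with Kraus operators `K i` on its own system (its system after
outcome `i`, with basis `E i`, may depend on `i`), announces `i`, and the parties go on with
an LOCC protocol `Λ i` that may depend on `i`. The final record of outcomes is forgotten.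
A local channel is the case in which `Λ i` does not depend on `i`. -/
inductive IsLOCC {A' B' : Type} [Fintype A'] [DecidableEq A'] [Fintype B'] [DecidableEq B'] :
    ∀ {A B : Type} [Fintype A] [DecidableEq A] [Fintype B] [DecidableEq B],
      (Matrix (A × B) (A × B) ℂ → Matrix (A' × B') (A' × B') ℂ) → Prop
  | done : IsLOCC (A := A') (B := B') (fun X => X)
  | alice {A B : Type} [Fintype A] [DecidableEq A] [Fintype B] [DecidableEq B]
      {ι : Type} [Fintype ι] {E : ι → Type} [∀ i, Fintype (E i)] [∀ i, DecidableEq (E i)]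
      (K : ∀ i, Matrix (E i) A ℂ) (hK : ∑ i, (K i)ᴴ * K i = 1)
      (Λ : ∀ i, Matrix (E i × B) (E i × B) ℂ → Matrix (A' × B') (A' × B') ℂ)
      (hΛ : ∀ i, IsLOCC (Λ i)) :
      IsLOCC (fun X : Matrix (A × B) (A × B) ℂ =>
        ∑ i, Λ i ((K i ⊗ₖ (1 : Matrix B B ℂ)) * X * (K i ⊗ₖ (1 : Matrix B B ℂ))ᴴ))
  | bob {A B : Type} [Fintype A] [DecidableEq A] [Fintype B] [DecidableEq B]
      {ι : Type} [Fintype ι] {E : ι → Type} [∀ i, Fintype (E i)] [∀ i, DecidableEq (E i)]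
      (K : ∀ i, Matrix (E i) B ℂ) (hK : ∑ i, (K i)ᴴ * K i = 1)
      (Λ : ∀ i, Matrix (A × E i) (A × E i) ℂ → Matrix (A' × B') (A' × B') ℂ)
      (hΛ : ∀ i, IsLOCC (Λ i)) :
      IsLOCC (fun X : Matrix (A × B) (A × B) ℂ =>
        ∑ i, Λ i (((1 : Matrix A A ℂ) ⊗ₖ K i) * X * ((1 : Matrix A A ℂ) ⊗ₖ K i)ᴴ))

/-- `ρ^{⊗ n}` as a bipartite state: Alice holds the `n` copies of `A`, Bob those of `B`. -/
def copies {A B : Type} (ρ : Matrix (A × B) (A × B) ℂ) (n : ℕ) :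
    Matrix ((Fin n → A) × (Fin n → B)) ((Fin n → A) × (Fin n → B)) ℂ :=
  fun x y => ∏ i, ρ (x.1 i, x.2 i) (y.1 i, y.2 i)

/-- `ρ ⊗ τ` for two bipartite states, regrouped into Alice's and Bob's parts. -/
def withCatalyst {A B C D : Type} (ρ : Matrix (A × B) (A × B) ℂ)
    (τ : Matrix (C × D) (C × D) ℂ) : Matrix ((A × C) × (B × D)) ((A × C) × (B × D)) ℂ :=
  fun x y => ρ (x.1.1, x.2.1) (y.1.1, y.2.1) * τ (x.1.2, x.2.2) (y.1.2, y.2.2)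

/-- The reduced state `μ^S` of `μ^{SC}`: the catalyst is traced out. -/
def systemPart {A B C D : Type} [Fintype C] [Fintype D]
    (μ : Matrix ((A × C) × (B × D)) ((A × C) × (B × D)) ℂ) : Matrix (A × B) (A × B) ℂ :=
  fun x y => ∑ c : C, ∑ d : D, μ ((x.1, c), (x.2, d)) ((y.1, c), (y.2, d))

/-- The reduced state `μ^C` of `μ^{SC}`: the system is traced out. -/
def catalystPart {A B C D : Type} [Fintype A] [Fintype B]
    (μ : Matrix ((A × C) × (B × D)) ((A × C) × (B × D)) ℂ) : Matrix (C × D) (C × D) ℂ :=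
  fun x y => ∑ a : A, ∑ b : B, μ ((a, x.1), (b, x.2)) ((a, y.1), (b, y.2))

/-- The reduced state `μ^{S_i}` of `μ^{S_1 … S_m}`: the sum runs over the basis labels `u`, `v`
of Alice's and Bob's systems with `i`-th entries the row index `x`; the column index agrees with
them except in the `i`-th entries, which are `y`. -/
def marginal {A B : Type} [Fintype A] [DecidableEq A] [Fintype B] [DecidableEq B] {m : ℕ}
    (μ : Matrix ((Fin m → A) × (Fin m → B)) ((Fin m → A) × (Fin m → B)) ℂ) (i : Fin m) :
    Matrix (A × B) (A × B) ℂ :=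
  fun x y => ∑ u : Fin m → A, ∑ v : Fin m → B,
    if u i = x.1 ∧ v i = x.2 then
      μ (u, v) (Function.update u i y.1, Function.update v i y.2) else 0

/-- The vector `(|01⟩ - |10⟩) / √2`. -/
def singletVec : Fin 2 × Fin 2 → ℂ := fun x =>
  if x = (0, 1) then ((Real.sqrt 2 : ℝ) : ℂ)⁻¹
  else if x = (1, 0) then -((Real.sqrt 2 : ℝ) : ℂ)⁻¹ else 0

/-- The singlet, as a density matrix of two qubits. -/
def singlet : Matrix (Fin 2 × Fin 2) (Fin 2 × Fin 2) ℂ :=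
  Matrix.vecMulVec singletVec (star singletVec)

section Rates

variable {A B A' B' : Type} [Fintype A] [DecidableEq A] [Fintype B] [DecidableEq B]
  [Fintype A'] [DecidableEq A'] [Fintype B'] [DecidableEq B']

/-- An asymptotic transformation from `ρ` into `σ` is possible at rate `r`. -/
def Achievable (ρ : Matrix (A × B) (A × B) ℂ) (σ : Matrix (A' × B') (A' × B') ℂ)
    (r : ℝ) : Prop :=
  ∀ ε : ℝ, 0 < ε → ∀ δ : ℝ, 0 < δ → ∃ m n : ℕ, 0 < n ∧
    ∃ Λ : Matrix ((Fin n → A) × (Fin n → B)) ((Fin n → A) × (Fin n → B)) ℂ →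
        Matrix ((Fin m → A') × (Fin m → B')) ((Fin m → A') × (Fin m → B')) ℂ,
      IsLOCC Λ ∧
      traceNorm (Λ (copies ρ n) - copies σ m) < ε ∧
      r < (m : ℝ) / (n : ℝ) + δ

/-- A marginal asymptotic transformation from `ρ` to `σ` is possible at rate `r`. -/
def MarginalAchievable (ρ : Matrix (A × B) (A × B) ℂ) (σ : Matrix (A' × B') (A' × B') ℂ)
    (r : ℝ) : Prop :=
  ∀ ε : ℝ, 0 < ε → ∀ δ : ℝ, 0 < δ → ∃ m n : ℕ, 0 < n ∧
    ∃ Λ : Matrix ((Fin n → A) × (Fin n → B)) ((Fin n → A) × (Fin n → B)) ℂ →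
        Matrix ((Fin m → A') × (Fin m → B')) ((Fin m → A') × (Fin m → B')) ℂ,
      IsLOCC Λ ∧
      (∀ i, traceNorm (marginal (Λ (copies ρ n)) i - σ) < ε) ∧
      r < (m : ℝ) / (n : ℝ) + δ

/-- A marginal asymptotic transformation with correlated catalysis from `ρ` to `σ` is possible
at rate `r`. The catalyst is an arbitrary bipartite state of finite dimensions `c`, `d`. -/
def MarginalCatalyticAchievable (ρ : Matrix (A × B) (A × B) ℂ)
    (σ : Matrix (A' × B') (A' × B') ℂ) (r : ℝ) : Prop :=
  ∀ ε : ℝ, 0 < ε → ∀ δ : ℝ, 0 < δ → ∃ m n : ℕ, 0 < n ∧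
    ∃ (c d : ℕ) (τ : Matrix (Fin c × Fin d) (Fin c × Fin d) ℂ), IsState τ ∧
    ∃ Λ : Matrix (((Fin n → A) × Fin c) × ((Fin n → B) × Fin d))
            (((Fin n → A) × Fin c) × ((Fin n → B) × Fin d)) ℂ →
          Matrix (((Fin m → A') × Fin c) × ((Fin m → B') × Fin d))
            (((Fin m → A') × Fin c) × ((Fin m → B') × Fin d)) ℂ,
      IsLOCC Λ ∧
      (∀ i, traceNorm (marginal (systemPart (Λ (withCatalyst (copies ρ n) τ))) i - σ) < ε) ∧
      catalystPart (Λ (withCatalyst (copies ρ n) τ)) = τ ∧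
      r < (m : ℝ) / (n : ℝ) + δ

/-- The transformation rate `R(ρ → σ)`. -/
def rate (ρ : Matrix (A × B) (A × B) ℂ) (σ : Matrix (A' × B') (A' × B') ℂ) : EReal :=
  ⨆ (r : ℝ) (_ : Achievable ρ σ r), (r : EReal)

/-- The marginal transformation rate `R_m(ρ → σ)`. -/
def marginalRate (ρ : Matrix (A × B) (A × B) ℂ) (σ : Matrix (A' × B') (A' × B') ℂ) : EReal :=
  ⨆ (r : ℝ) (_ : MarginalAchievable ρ σ r), (r : EReal)

/-- The marginal catalytic transformation rate `R_mc(ρ → σ)`. -/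
def marginalCatalyticRate (ρ : Matrix (A × B) (A × B) ℂ)
    (σ : Matrix (A' × B') (A' × B') ℂ) : EReal :=
  ⨆ (r : ℝ) (_ : MarginalCatalyticAchievable ρ σ r), (r : EReal)

/-- A state is distillable if it can be converted into singlets at a nonzero rate. -/
def Distillable (ρ : Matrix (A × B) (A × B) ℂ) : Prop :=
  0 < rate ρ singlet

end Rates

end LOCCRates

end

/-! A marginal protocol is a catalytic one with a one-dimensional catalyst, so only
`MarginalCatalyticAchievable.marginalAchievable` needs work. Given a catalytic protocol on `n`
copies with catalyst `τ`, the catalyst can be used again and again. It comes back exactly in the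
state `τ`, correlated only with outputs already produced, so on `n` fresh copies the next run sees
exactly `ρ^{⊗n} ⊗ τ` as its reduced input and yields the same marginals (`exists_isLOCC_sequential`,
`exists_isLOCC_iterate`). Marginal closeness ignores the correlations that build up between outputs.

The initial `τ` is itself made from copies of `ρ`: distillability gives approximate singlets,
several of them form a large maximally entangled state, and teleportation turns that into any state
(`exists_isLOCC_pureState_eq`, `Distillable.preparable`). This costs a number `n₀` of copies
independent of the number `k` of runs, so the rate `mk/(nk + n₀)` tends to `m/n`. The preparation
error does not accumulate: each output marginal is the image of the whole input under one LOCC map,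
and such maps contract the trace norm (`IsLOCC.traceNorm_le`). -/

namespace LOCCRates

set_option linter.unusedSectionVars false

/-! ### Trace norm of Hermitian matrices: triangle inequality and contractivity. -/

section TraceNorm

variable {I J : Type} [Fintype I] [DecidableEq I] [Fintype J] [DecidableEq J]

lemma exists_unitary_diagonalization {M : Matrix I I ℂ} (hM : M.IsHermitian) :
    ∃ U : Matrix I I ℂ, Uᴴ * U = 1 ∧ U * Uᴴ = 1 ∧
      M = U * Matrix.diagonal (fun i => (hM.eigenvalues i : ℂ)) * Uᴴ := by
  refine ⟨hM.eigenvectorUnitary, ?_, ?_, ?_⟩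
  · exact Unitary.coe_star_mul_self _
  · exact Unitary.coe_mul_star_self _
  · conv_lhs => rw [hM.spectral_theorem, Unitary.conjStarAlgAut_apply]
    rfl

/-- The eigenvalues of `Mᴴ * M` are the squares of those of `M`, but the two enumerations need not
match. They are compared as multisets of roots of one characteristic polynomial. -/
lemma traceNorm_eq_sum_abs_eigenvalues {M : Matrix I I ℂ} (hM : M.IsHermitian) :
    traceNorm M = ∑ i, |hM.eigenvalues i| := by
  obtain ⟨U, hU, hU', hMU⟩ := exists_unitary_diagonalization hM
  have h1 : (Mᴴ * M).charpoly =
      (Matrix.diagonal (fun i => ((hM.eigenvalues i ^ 2 : ℝ) : ℂ))).charpoly := by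
    have : Mᴴ * M = U * (Matrix.diagonal (fun i => ((hM.eigenvalues i ^ 2 : ℝ) : ℂ)) * Uᴴ) := by
      rw [hM.eq]
      conv_lhs => rw [hMU]
      have hD : (Matrix.diagonal (fun i => ((hM.eigenvalues i ^ 2 : ℝ) : ℂ))) =
          Matrix.diagonal (fun i => (hM.eigenvalues i : ℂ)) *
            Matrix.diagonal (fun i => (hM.eigenvalues i : ℂ)) := by
        rw [Matrix.diagonal_mul_diagonal]; congr 1; ext i; push_cast; ring
      rw [hD]
      calc _ = U * Matrix.diagonal (fun i => (hM.eigenvalues i : ℂ)) * (Uᴴ * U) *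
            Matrix.diagonal (fun i => (hM.eigenvalues i : ℂ)) * Uᴴ := by
            simp only [Matrix.mul_assoc]
        _ = _ := by rw [hU, Matrix.mul_one]; simp only [Matrix.mul_assoc]
    rw [this, Matrix.charpoly_mul_comm, Matrix.mul_assoc, hU, Matrix.mul_one]
  have h2 := (Matrix.isHermitian_conjTranspose_mul_self M).roots_charpoly_eq_eigenvalues
  rw [h1, Matrix.charpoly_diagonal, Polynomial.roots_prod _ _
    (Finset.prod_ne_zero_iff.2 fun i _ => Polynomial.X_sub_C_ne_zero _)] at h2
  simp only [Polynomial.roots_X_sub_C, Multiset.bind_singleton] at h2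
  have h3 := congrArg (fun s => (s.map fun z : ℂ => Real.sqrt z.re).sum) h2
  simp only [Multiset.map_map, Function.comp_def, Complex.ofReal_re, Complex.coe_algebraMap] at h3
  rw [traceNorm, ← show _ = ∑ i, |hM.eigenvalues i| from
    Finset.sum_congr rfl fun i _ => Real.sqrt_sq_eq_abs _]
  exact h3.symm

/-- The trace norm of a Hermitian matrix is attained by its Jordan decomposition. -/
lemma exists_posSemidef_sub_eq {M : Matrix I I ℂ} (hM : M.IsHermitian) :
    ∃ P Q : Matrix I I ℂ, P.PosSemidef ∧ Q.PosSemidef ∧ M = P - Q ∧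
      traceNorm M = P.trace.re + Q.trace.re := by
  obtain ⟨U, hU, hU', hMU⟩ := exists_unitary_diagonalization hM
  have key : ∀ f : I → ℝ, (∀ i, 0 ≤ f i) →
      (U * Matrix.diagonal (fun i => (f i : ℂ)) * Uᴴ).PosSemidef ∧
      (U * Matrix.diagonal (fun i => (f i : ℂ)) * Uᴴ).trace.re = ∑ i, f i := by
    intro f hf
    refine ⟨(Matrix.PosSemidef.diagonal fun i => ?_).mul_mul_conjTranspose_same U, ?_⟩
    · simpa using hf i
    · rw [Matrix.trace_mul_comm, ← Matrix.mul_assoc, hU, Matrix.one_mul, Matrix.trace_diagonal]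
      simp
  obtain ⟨hP, hP'⟩ := key (fun i => (hM.eigenvalues i)⁺) fun i => posPart_nonneg _
  obtain ⟨hQ, hQ'⟩ := key (fun i => (hM.eigenvalues i)⁻) fun i => negPart_nonneg _
  refine ⟨_, _, hP, hQ, ?_, ?_⟩
  · conv_lhs => rw [hMU]
    rw [← Matrix.sub_mul, ← Matrix.mul_sub, Matrix.diagonal_sub]
    congr 3; ext i
    rw [← Complex.ofReal_sub, posPart_sub_negPart]
  · rw [hP', hQ', traceNorm_eq_sum_abs_eigenvalues hM, ← Finset.sum_add_distrib]
    exact Finset.sum_congr rfl fun i _ => (posPart_add_negPart _).symm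

/-- In an eigenbasis of `P - Q` each eigenvalue is a difference of nonnegative diagonal entries of
`P` and `Q`, hence bounded by their sum. With `exists_posSemidef_sub_eq` this makes the trace norm
the minimum of `Tr P + Tr Q` over all such decompositions, from which the triangle inequality and
contractivity follow. -/
lemma traceNorm_sub_le {P Q : Matrix I I ℂ} (hP : P.PosSemidef) (hQ : Q.PosSemidef) :
    traceNorm (P - Q) ≤ P.trace.re + Q.trace.re := by
  have hM : (P - Q).IsHermitian := hP.isHermitian.sub hQ.isHermitian
  obtain ⟨U, hU, hU', hMU⟩ := exists_unitary_diagonalization hM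
  have key : ∀ R : Matrix I I ℂ, (Uᴴ * R * U).trace = R.trace := fun R => by
    rw [Matrix.trace_mul_comm, ← Matrix.mul_assoc, hU', Matrix.one_mul]
  have hd : Matrix.diagonal (fun i => (hM.eigenvalues i : ℂ)) = Uᴴ * P * U - Uᴴ * Q * U := by
    rw [← Matrix.sub_mul, ← Matrix.mul_sub]
    conv_rhs => rw [hMU]
    simp only [← Matrix.mul_assoc]
    rw [hU, Matrix.one_mul, Matrix.mul_assoc, hU, Matrix.mul_one]
  have hP' := hP.conjTranspose_mul_mul_same U
  have hQ' := hQ.conjTranspose_mul_mul_same U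
  rw [traceNorm_eq_sum_abs_eigenvalues hM, ← key P, ← key Q]
  simp only [Matrix.trace, Complex.re_sum, Matrix.diag_apply, ← Finset.sum_add_distrib]
  refine Finset.sum_le_sum fun i _ => ?_
  have h1 := congrFun (congrFun hd i) i
  rw [Matrix.diagonal_apply_eq, Matrix.sub_apply] at h1
  have h2 := congrArg Complex.re h1
  rw [Complex.ofReal_re, Complex.sub_re] at h2
  have h3 := (Complex.le_def.1 (hP'.diag_nonneg (i := i))).1
  have h4 := (Complex.le_def.1 (hQ'.diag_nonneg (i := i))).1
  rw [Complex.zero_re] at h3 h4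
  rw [h2, abs_le]
  constructor <;> linarith

lemma traceNorm_add_le {M N : Matrix I I ℂ} (hM : M.IsHermitian) (hN : N.IsHermitian) :
    traceNorm (M + N) ≤ traceNorm M + traceNorm N := by
  obtain ⟨P, Q, hP, hQ, rfl, h⟩ := exists_posSemidef_sub_eq hM
  obtain ⟨P', Q', hP', hQ', rfl, h'⟩ := exists_posSemidef_sub_eq hN
  rw [h, h', sub_add_sub_comm]
  refine (traceNorm_sub_le (hP.add hP') (hQ.add hQ')).trans_eq ?_
  simp only [Matrix.trace_add, Complex.add_re]; ring

lemma traceNorm_zero : traceNorm (0 : Matrix I I ℂ) = 0 := by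
  have h0 := traceNorm_sub_le (I := I) Matrix.PosSemidef.zero Matrix.PosSemidef.zero
  refine le_antisymm (by simpa using h0) (Finset.sum_nonneg fun i _ => Real.sqrt_nonneg _)

/-- A positive trace-preserving additive map does not increase the trace norm of a Hermitian
matrix. -/
lemma traceNorm_map_le {F : Matrix I I ℂ → Matrix J J ℂ} (hsub : ∀ X Y, F (X - Y) = F X - F Y)
    (hpos : ∀ X, X.PosSemidef → (F X).PosSemidef) (htr : ∀ X, (F X).trace = X.trace)
    {M : Matrix I I ℂ} (hM : M.IsHermitian) : traceNorm (F M) ≤ traceNorm M := by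
  obtain ⟨P, Q, hP, hQ, rfl, h⟩ := exists_posSemidef_sub_eq hM
  rw [h, hsub, ← htr P, ← htr Q]
  exact traceNorm_sub_le (hpos P hP) (hpos Q hQ)

end TraceNorm

/-! ### Bipartite tensor calculus and closure properties of LOCC maps. -/

section Calculus

variable {A B A' B' A₁ B₁ A₂ B₂ C D E F : Type}

/-- Local relabelling of the basis vectors. -/
def relabel (f : A ≃ A₂) (g : B ≃ B₂) (X : Matrix (A × B) (A × B) ℂ) :
    Matrix (A₂ × B₂) (A₂ × B₂) ℂ :=
  X.submatrix (Prod.map f.symm g.symm) (Prod.map f.symm g.symm)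

/-- The block of a matrix obtained by fixing the row and the column index of the second
system. -/
def block (X : Matrix ((A × E) × (B × F)) ((A × E) × (B × F)) ℂ) (p q : E × F) :
    Matrix (A × B) (A × B) ℂ :=
  X.submatrix (fun z => ((z.1, p.1), (z.2, p.2))) (fun z => ((z.1, q.1), (z.2, q.2)))

/-- The map `Λ ⊗ id`, which leaves a second bipartite system untouched. -/
def withIdle (E F : Type) (Λ : Matrix (A × B) (A × B) ℂ → Matrix (A' × B') (A' × B') ℂ)
    (X : Matrix ((A × E) × (B × F)) ((A × E) × (B × F)) ℂ) :
    Matrix ((A' × E) × (B' × F)) ((A' × E) × (B' × F)) ℂ :=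
  fun x y => Λ (block X (x.1.2, x.2.2) (y.1.2, y.2.2)) (x.1.1, x.2.1) (y.1.1, y.2.1)

lemma block_withIdle (Λ : Matrix (A × B) (A × B) ℂ → Matrix (A' × B') (A' × B') ℂ)
    (X : Matrix ((A × E) × (B × F)) ((A × E) × (B × F)) ℂ) (p q : E × F) :
    block (withIdle E F Λ X) p q = Λ (block X p q) := rfl

lemma ext_block {X Y : Matrix ((A × E) × (B × F)) ((A × E) × (B × F)) ℂ}
    (h : ∀ p q, block X p q = block Y p q) : X = Y := by
  ext ⟨⟨a, e⟩, ⟨b, f⟩⟩ ⟨⟨a', e'⟩, ⟨b', f'⟩⟩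
  exact congrFun (congrFun (h (e, f) (e', f')) (a, b)) (a', b')

lemma block_sum {ι : Type} [Fintype ι]
    (X : ι → Matrix ((A × E) × (B × F)) ((A × E) × (B × F)) ℂ) (p q : E × F) :
    block (∑ i, X i) p q = ∑ i, block (X i) p q := by
  ext x y; simp [block, Matrix.sum_apply]

lemma block_withCatalyst (ρ : Matrix (A × B) (A × B) ℂ) (τ : Matrix (C × D) (C × D) ℂ)
    (p q : C × D) : block (withCatalyst ρ τ) p q = τ p q • ρ := by
  ext x y; simp [block, withCatalyst, mul_comm]

lemma systemPart_eq_sum_block [Fintype C] [Fintype D]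
    (μ : Matrix ((A × C) × (B × D)) ((A × C) × (B × D)) ℂ) :
    systemPart μ = ∑ p, block μ p p := by
  ext x y
  simp [systemPart, block, Matrix.sum_apply, Fintype.sum_prod_type]

lemma catalystPart_eq_trace_block [Fintype A] [Fintype B]
    (μ : Matrix ((A × C) × (B × D)) ((A × C) × (B × D)) ℂ) (x y : C × D) :
    catalystPart μ x y = (block μ x y).trace := by
  simp [catalystPart, block, Matrix.trace, Fintype.sum_prod_type]

/-- Interchange of the two factors of a bipartite tensor product. -/
def swapParts (X : Matrix ((A × E) × (B × F)) ((A × E) × (B × F)) ℂ) :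
    Matrix ((E × A) × (F × B)) ((E × A) × (F × B)) ℂ :=
  relabel (Equiv.prodComm A E) (Equiv.prodComm B F) X

lemma systemPart_swapParts [Fintype A] [Fintype B]
    (X : Matrix ((A × E) × (B × F)) ((A × E) × (B × F)) ℂ) :
    systemPart (swapParts X) = catalystPart X := rfl

lemma swapParts_withCatalyst (ρ : Matrix (A × B) (A × B) ℂ) (τ : Matrix (C × D) (C × D) ℂ) :
    swapParts (withCatalyst ρ τ) = withCatalyst τ ρ := by
  ext x y; simp [swapParts, relabel, withCatalyst, mul_comm]

variable [Fintype A] [DecidableEq A] [Fintype B] [DecidableEq B]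
  [Fintype A'] [DecidableEq A'] [Fintype B'] [DecidableEq B']
  [Fintype A₁] [DecidableEq A₁] [Fintype B₁] [DecidableEq B₁]
  [Fintype A₂] [DecidableEq A₂] [Fintype B₂] [DecidableEq B₂]
  [Fintype C] [DecidableEq C] [Fintype D] [DecidableEq D]
  [Fintype E] [DecidableEq E] [Fintype F] [DecidableEq F]


/-- The linear map `X ↦ K X Kᴴ`. -/
def kraus {I J : Type} [Fintype I] (K : Matrix J I ℂ) : Matrix I I ℂ →ₗ[ℂ] Matrix J J ℂ where
  toFun X := K * X * Kᴴ
  map_add' X Y := by rw [Matrix.mul_add, Matrix.add_mul]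
  map_smul' c X := by simp

lemma trace_sum_kraus {I ι : Type} [Fintype I] [DecidableEq I] [Fintype ι] {E : ι → Type}
    [∀ i, Fintype (E i)] (K : ∀ i, Matrix (E i) I ℂ) (hK : ∑ i, (K i)ᴴ * K i = 1)
    (X : Matrix I I ℂ) : ∑ i, (K i * X * (K i)ᴴ).trace = X.trace := by
  calc _ = ∑ i, ((K i)ᴴ * K i * X).trace := Finset.sum_congr rfl fun i _ => by
        rw [Matrix.trace_mul_comm, Matrix.mul_assoc]
    _ = X.trace := by
        rw [← Matrix.trace_sum, ← Finset.sum_mul, hK, Matrix.one_mul]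

lemma sum_kronecker_one_eq_one {ι : Type} [Fintype ι] {E : ι → Type}
    [∀ i, Fintype (E i)] (K : ∀ i, Matrix (E i) A ℂ) (hK : ∑ i, (K i)ᴴ * K i = 1) :
    ∑ i, (K i ⊗ₖ (1 : Matrix B B ℂ))ᴴ * (K i ⊗ₖ (1 : Matrix B B ℂ)) = 1 := by
  simp_rw [Matrix.conjTranspose_kronecker, ← Matrix.mul_kronecker_mul, Matrix.conjTranspose_one,
    Matrix.one_mul]
  rw [← Matrix.one_kronecker_one (m := A) (n := B), ← hK]
  ext x y
  simp [Matrix.sum_apply, Finset.sum_mul]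

lemma sum_one_kronecker_eq_one {ι : Type} [Fintype ι] {E : ι → Type}
    [∀ i, Fintype (E i)] (K : ∀ i, Matrix (E i) B ℂ) (hK : ∑ i, (K i)ᴴ * K i = 1) :
    ∑ i, ((1 : Matrix A A ℂ) ⊗ₖ K i)ᴴ * ((1 : Matrix A A ℂ) ⊗ₖ K i) = 1 := by
  simp_rw [Matrix.conjTranspose_kronecker, ← Matrix.mul_kronecker_mul, Matrix.conjTranspose_one,
    Matrix.one_mul]
  rw [← Matrix.one_kronecker_one (m := A) (n := B), ← hK]
  ext x y
  simp [Matrix.sum_apply, Finset.mul_sum]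

/-- A Kraus operator acting as the identity on the idle system acts on each block separately. This
is the inductive step of `IsLOCC.withIdle`. -/
lemma block_conj_alice {A₁ : Type} [Fintype A₁] (K : Matrix A₁ A ℂ)
    (X : Matrix ((A × E) × (B × F)) ((A × E) × (B × F)) ℂ) (p q : E × F) :
    block (((K ⊗ₖ (1 : Matrix E E ℂ)) ⊗ₖ (1 : Matrix (B × F) (B × F) ℂ)) * X *
      ((K ⊗ₖ (1 : Matrix E E ℂ)) ⊗ₖ (1 : Matrix (B × F) (B × F) ℂ))ᴴ) p q =
    (K ⊗ₖ (1 : Matrix B B ℂ)) * block X p q * (K ⊗ₖ (1 : Matrix B B ℂ))ᴴ := by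
  ext ⟨a, b⟩ ⟨a', b'⟩
  simp [block, Matrix.mul_apply, Fintype.sum_prod_type, Matrix.one_apply, Prod.ext_iff,
    ite_and, Finset.sum_ite_eq, apply_ite]

lemma block_conj_bob {B₁ : Type} [Fintype B₁] (K : Matrix B₁ B ℂ)
    (X : Matrix ((A × E) × (B × F)) ((A × E) × (B × F)) ℂ) (p q : E × F) :
    block (((1 : Matrix (A × E) (A × E) ℂ) ⊗ₖ (K ⊗ₖ (1 : Matrix F F ℂ))) * X *
      ((1 : Matrix (A × E) (A × E) ℂ) ⊗ₖ (K ⊗ₖ (1 : Matrix F F ℂ)))ᴴ) p q =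
    ((1 : Matrix A A ℂ) ⊗ₖ K) * block X p q * ((1 : Matrix A A ℂ) ⊗ₖ K)ᴴ := by
  ext ⟨a, b⟩ ⟨a', b'⟩
  simp [block, Matrix.mul_apply, Fintype.sum_prod_type, Matrix.one_apply, Prod.ext_iff,
    ite_and, Finset.sum_ite_eq, apply_ite]

namespace IsLOCC

lemma exists_linearMap {Λ : Matrix (A × B) (A × B) ℂ → Matrix (A' × B') (A' × B') ℂ}
    (h : IsLOCC Λ) :
    ∃ L : Matrix (A × B) (A × B) ℂ →ₗ[ℂ] Matrix (A' × B') (A' × B') ℂ, Λ = L := by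
  induction h with
  | done => exact ⟨LinearMap.id, rfl⟩
  | alice K hK Λ hΛ ih =>
    choose L hL using ih
    exact ⟨∑ i, L i ∘ₗ kraus (K i ⊗ₖ 1), by ext1 X; simp [hL, kraus]⟩
  | bob K hK Λ hΛ ih =>
    choose L hL using ih
    exact ⟨∑ i, L i ∘ₗ kraus (1 ⊗ₖ K i), by ext1 X; simp [hL, kraus]⟩

variable {Λ : Matrix (A × B) (A × B) ℂ → Matrix (A' × B') (A' × B') ℂ}

lemma map_sub (h : IsLOCC Λ) (X Y : Matrix (A × B) (A × B) ℂ) : Λ (X - Y) = Λ X - Λ Y := by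
  obtain ⟨L, rfl⟩ := h.exists_linearMap; exact _root_.map_sub L X Y

lemma map_smul (h : IsLOCC Λ) (c : ℂ) (X : Matrix (A × B) (A × B) ℂ) :
    Λ (c • X) = c • Λ X := by
  obtain ⟨L, rfl⟩ := h.exists_linearMap; exact _root_.map_smul L c X

lemma map_sum (h : IsLOCC Λ) {ι : Type} (s : Finset ι) (X : ι → Matrix (A × B) (A × B) ℂ) :
    Λ (∑ i ∈ s, X i) = ∑ i ∈ s, Λ (X i) := by
  obtain ⟨L, rfl⟩ := h.exists_linearMap; exact _root_.map_sum L X s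

lemma posSemidef (h : IsLOCC Λ) {X : Matrix (A × B) (A × B) ℂ} (hX : X.PosSemidef) :
    (Λ X).PosSemidef := by
  induction h with
  | done => exact hX
  | alice K hK Λ hΛ ih =>
    exact Matrix.posSemidef_sum _ fun i _ => ih i (hX.mul_mul_conjTranspose_same _)
  | bob K hK Λ hΛ ih =>
    exact Matrix.posSemidef_sum _ fun i _ => ih i (hX.mul_mul_conjTranspose_same _)

lemma trace_eq (h : IsLOCC Λ) (X : Matrix (A × B) (A × B) ℂ) : (Λ X).trace = X.trace := by
  induction h with
  | done => rfl
  | alice K hK Λ hΛ ih =>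
    rw [Matrix.trace_sum]
    simp_rw [ih]
    exact trace_sum_kraus _ (sum_kronecker_one_eq_one K hK) X
  | bob K hK Λ hΛ ih =>
    rw [Matrix.trace_sum]
    simp_rw [ih]
    exact trace_sum_kraus _ (sum_one_kronecker_eq_one K hK) X

lemma isState (h : IsLOCC Λ) {X : Matrix (A × B) (A × B) ℂ} (hX : IsState X) :
    IsState (Λ X) :=
  ⟨h.posSemidef hX.1, (h.trace_eq X).trans hX.2⟩

lemma traceNorm_le (h : IsLOCC Λ) {M : Matrix (A × B) (A × B) ℂ} (hM : M.IsHermitian) :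
    traceNorm (Λ M) ≤ traceNorm M :=
  traceNorm_map_le h.map_sub (fun _ => h.posSemidef) h.trace_eq hM

/-- By linearity the second protocol can be grafted onto every leaf of the first protocol's tree. -/
lemma comp (h : IsLOCC Λ) {Λ₂ : Matrix (A' × B') (A' × B') ℂ → Matrix (A₂ × B₂) (A₂ × B₂) ℂ}
    (h₂ : IsLOCC Λ₂) : IsLOCC (fun X => Λ₂ (Λ X)) := by
  induction h with
  | done => exact h₂
  | alice K hK Λ hΛ ih =>
    simp_rw [h₂.map_sum]
    exact alice K hK (fun i X => Λ₂ (Λ i X)) ih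
  | bob K hK Λ hΛ ih =>
    simp_rw [h₂.map_sum]
    exact bob K hK (fun i X => Λ₂ (Λ i X)) ih

lemma withIdle (h : IsLOCC Λ) (E F : Type) [Fintype E] [DecidableEq E] [Fintype F]
    [DecidableEq F] : IsLOCC (withIdle E F Λ) := by
  induction h with
  | done => exact done
  | alice K hK Λ hΛ ih =>
    have := alice (B := _ × F) (fun i => K i ⊗ₖ (1 : Matrix E E ℂ))
      (sum_kronecker_one_eq_one K hK) (fun i => LOCCRates.withIdle E F (Λ i)) ih
    convert this using 2 with X
    refine ext_block fun p q => ?_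
    simp only [block_sum, block_withIdle, block_conj_alice]
  | bob K hK Λ hΛ ih =>
    have := bob (A := _ × E) (fun i => K i ⊗ₖ (1 : Matrix F F ℂ))
      (sum_kronecker_one_eq_one K hK) (fun i => LOCCRates.withIdle E F (Λ i)) ih
    convert this using 2 with X
    refine ext_block fun p q => ?_
    simp only [block_sum, block_withIdle, block_conj_bob]

/-- One-way LOCC: Alice measures, Bob measures depending on her outcome. -/
lemma oneWay {ι κ : Type} [Fintype ι] [Fintype κ] (K : ι → Matrix A' A ℂ)
    (L : ι → κ → Matrix B' B ℂ) (hK : ∑ i, (K i)ᴴ * K i = 1)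
    (hL : ∀ i, ∑ l, (L i l)ᴴ * L i l = 1) :
    IsLOCC (fun X : Matrix (A × B) (A × B) ℂ =>
      ∑ i, ∑ l, (K i ⊗ₖ L i l) * X * (K i ⊗ₖ L i l)ᴴ) := by
  have := alice (B := B) K hK _ fun i => bob (A := A') (L i) (hL i) _ fun l => done
  convert this using 5 with X i _ l _
  rw [show K i ⊗ₖ L i l = ((1 : Matrix A' A' ℂ) ⊗ₖ L i l) * (K i ⊗ₖ (1 : Matrix B B ℂ)) by
    rw [← Matrix.mul_kronecker_mul, Matrix.one_mul, Matrix.mul_one], Matrix.conjTranspose_mul]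
  simp only [Matrix.mul_assoc]

end IsLOCC

/-- The matrix sending the basis vector `k e` to `e`, and the remaining ones to zero. -/
def selector {I J : Type} [DecidableEq I] (k : J → I) : Matrix J I ℂ :=
  (1 : Matrix I I ℂ).submatrix k id

lemma selector_conj {E F : Type} [Fintype E] [Fintype F] (k : E → A) (l : F → B)
    (X : Matrix (A × B) (A × B) ℂ) :
    (selector k ⊗ₖ selector l) * X * (selector k ⊗ₖ selector l)ᴴ =
      X.submatrix (Prod.map k l) (Prod.map k l) := by
  have : selector k ⊗ₖ selector l = (1 : Matrix (A × B) (A × B) ℂ).submatrix (Prod.map k l) id := by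
    ext x y; simp only [selector, Matrix.kroneckerMap_apply, Matrix.submatrix_apply, Matrix.one_apply,
      Prod.ext_iff, ite_and, Prod.map_fst, Prod.map_snd, id_eq]
    split_ifs <;> simp
  rw [this, Matrix.conjTranspose_submatrix, Matrix.conjTranspose_one]
  ext x y
  simp [Matrix.mul_apply, Matrix.one_apply]

lemma IsLOCC.relabel (f : A ≃ A') (g : B ≃ B') : IsLOCC (relabel f g) := by
  have key : ∀ {I J : Type} [Fintype I] [DecidableEq I] [Fintype J] [DecidableEq J] (f : I ≃ J),
      ∑ _i : Unit, (selector f.symm)ᴴ * selector f.symm = 1 := fun f => by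
    ext x y
    simp [selector, Matrix.one_apply]
  have := oneWay (fun _ : Unit => selector f.symm) (fun _ (_ : Unit) => selector g.symm)
    (key f) (fun _ => key g)
  simp only [selector_conj, Finset.univ_unique, Finset.sum_singleton] at this
  exact this

/-- Discarding a system amounts to both parties measuring it in the standard basis and forgetting
the outcomes. -/
lemma IsLOCC.systemPart :
    IsLOCC (systemPart : Matrix ((A × C) × (B × D)) ((A × C) × (B × D)) ℂ → _) := by
  have key : ∀ {I J : Type} [Fintype I] [DecidableEq I] [Fintype J] [DecidableEq J],
      ∑ j : J, (selector (fun i : I => (i, j)))ᴴ * selector (fun i : I => (i, j)) = 1 := by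
    intros I J _ _ _ _
    ext ⟨x, x'⟩ ⟨y, y'⟩
    simp [selector, Matrix.mul_apply, Matrix.one_apply, Matrix.sum_apply, Prod.ext_iff, ite_and,
      eq_comm]
  have := oneWay (fun c : C => selector (fun a : A => (a, c)))
    (fun _ (d : D) => selector (fun b : B => (b, d))) key (fun _ => key)
  convert this using 1
  ext X x y
  simp only [selector_conj, Matrix.sum_apply]
  rfl

lemma IsLOCC.swapParts :
    IsLOCC (swapParts : Matrix ((A × C) × (B × D)) ((A × C) × (B × D)) ℂ → _) :=
  IsLOCC.relabel _ _

lemma withCatalyst_eq_submatrix (ρ : Matrix (A × B) (A × B) ℂ) (τ : Matrix (C × D) (C × D) ℂ) :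
    withCatalyst ρ τ = (ρ ⊗ₖ τ).submatrix (Equiv.prodProdProdComm A C B D)
      (Equiv.prodProdProdComm A C B D) := rfl

lemma posSemidef_withCatalyst {ρ : Matrix (A × B) (A × B) ℂ} {τ : Matrix (C × D) (C × D) ℂ}
    (hρ : ρ.PosSemidef) (hτ : τ.PosSemidef) : (withCatalyst ρ τ).PosSemidef := by
  rw [withCatalyst_eq_submatrix]
  exact (hρ.kronecker hτ).submatrix _

lemma trace_withCatalyst (ρ : Matrix (A × B) (A × B) ℂ) (τ : Matrix (C × D) (C × D) ℂ) :
    (withCatalyst ρ τ).trace = ρ.trace * τ.trace :=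
  (Equiv.sum_comp (Equiv.prodProdProdComm A C B D) fun z => (ρ ⊗ₖ τ) z z).trans
    (Matrix.trace_kronecker ρ τ)

lemma IsState.withCatalyst {ρ : Matrix (A × B) (A × B) ℂ} {τ : Matrix (C × D) (C × D) ℂ}
    (hρ : IsState ρ) (hτ : IsState τ) : IsState (withCatalyst ρ τ) :=
  ⟨posSemidef_withCatalyst hρ.1 hτ.1, by rw [trace_withCatalyst, hρ.2, hτ.2, mul_one]⟩

lemma systemPart_withIdle {Λ : Matrix (A × B) (A × B) ℂ → Matrix (A' × B') (A' × B') ℂ}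
    (h : IsLOCC Λ) (X : Matrix ((A × E) × (B × F)) ((A × E) × (B × F)) ℂ) :
    systemPart (withIdle E F Λ X) = Λ (systemPart X) := by
  simp only [systemPart_eq_sum_block, block_withIdle, h.map_sum]

/-- No-signalling: tracing out the output of `Λ` undoes its effect because `Λ` preserves the trace
of every block, including the off-diagonal ones. -/
lemma catalystPart_withIdle {Λ : Matrix (A × B) (A × B) ℂ → Matrix (A' × B') (A' × B') ℂ}
    (h : IsLOCC Λ) (X : Matrix ((A × E) × (B × F)) ((A × E) × (B × F)) ℂ) :
    catalystPart (withIdle E F Λ X) = catalystPart X := by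
  ext x y
  simp only [catalystPart_eq_trace_block, block_withIdle, h.trace_eq]

lemma withIdle_withCatalyst {Λ : Matrix (A × B) (A × B) ℂ → Matrix (A' × B') (A' × B') ℂ}
    (h : IsLOCC Λ) (ρ : Matrix (A × B) (A × B) ℂ) (τ : Matrix (C × D) (C × D) ℂ) :
    withIdle C D Λ (withCatalyst ρ τ) = withCatalyst (Λ ρ) τ :=
  ext_block fun p q => by rw [block_withIdle, block_withCatalyst, block_withCatalyst, h.map_smul]

lemma systemPart_withCatalyst (ρ : Matrix (A × B) (A × B) ℂ) {τ : Matrix (C × D) (C × D) ℂ}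
    (hτ : τ.trace = 1) : systemPart (withCatalyst ρ τ) = ρ := by
  simp only [systemPart_eq_sum_block, block_withCatalyst, ← Finset.sum_smul]
  rw [show ∑ p, τ p p = 1 from hτ, one_smul]

lemma catalystPart_withCatalyst {ρ : Matrix (A × B) (A × B) ℂ} (hρ : ρ.trace = 1)
    (τ : Matrix (C × D) (C × D) ℂ) : catalystPart (withCatalyst ρ τ) = τ := by
  rw [← systemPart_swapParts, swapParts_withCatalyst, systemPart_withCatalyst _ hρ]

/-- Two LOCC protocols can be run in parallel. -/
lemma IsLOCC.exists_prod {Λ₁ : Matrix (A × B) (A × B) ℂ → Matrix (A₁ × B₁) (A₁ × B₁) ℂ}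
    {Λ₂ : Matrix (C × D) (C × D) ℂ → Matrix (A₂ × B₂) (A₂ × B₂) ℂ}
    (h₁ : IsLOCC Λ₁) (h₂ : IsLOCC Λ₂) :
    ∃ Λ : Matrix ((A × C) × (B × D)) ((A × C) × (B × D)) ℂ →
        Matrix ((A₁ × A₂) × (B₁ × B₂)) ((A₁ × A₂) × (B₁ × B₂)) ℂ,
      IsLOCC Λ ∧ ∀ ρ τ, Λ (withCatalyst ρ τ) = withCatalyst (Λ₁ ρ) (Λ₂ τ) :=
  ⟨_, (((h₁.withIdle C D).comp swapParts).comp (h₂.withIdle A₁ B₁)).comp swapParts, fun ρ τ => by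
    rw [withIdle_withCatalyst h₁, swapParts_withCatalyst, withIdle_withCatalyst h₂,
      swapParts_withCatalyst]⟩

lemma traceNorm_withCatalyst_le {M : Matrix (A × B) (A × B) ℂ} (hM : M.IsHermitian)
    {τ : Matrix (C × D) (C × D) ℂ} (hτ : IsState τ) :
    traceNorm (withCatalyst M τ) ≤ traceNorm M := by
  refine traceNorm_map_le (F := fun X => withCatalyst X τ) (fun X Y => ?_)
    (fun X hX => posSemidef_withCatalyst hX hτ.1)
    (fun X => by rw [trace_withCatalyst, hτ.2, mul_one]) hM
  ext x y; simp [withCatalyst, sub_mul]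

lemma traceNorm_withCatalyst_sub_le {ρ ρ' : Matrix (A × B) (A × B) ℂ}
    {τ τ' : Matrix (C × D) (C × D) ℂ} (hρ : IsState ρ) (hρ' : IsState ρ') (hτ : IsState τ)
    (hτ' : IsState τ') :
    traceNorm (withCatalyst ρ τ - withCatalyst ρ' τ') ≤ traceNorm (ρ - ρ') + traceNorm (τ - τ') := by
  have hH := hρ.1.isHermitian.sub hρ'.1.isHermitian
  have hH' := hτ.1.isHermitian.sub hτ'.1.isHermitian
  -- Telescoping through `ρ' ⊗ τ`; the swap puts the changing factor first in both terms.
  have h1 : withCatalyst ρ τ - withCatalyst ρ' τ' =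
      withCatalyst (ρ - ρ') τ + swapParts (withCatalyst (τ - τ') ρ') := by
    rw [swapParts_withCatalyst]
    ext x y; simp [withCatalyst]; ring
  have hh : ∀ {C D C' D' : Type} {M : Matrix (C × D) (C × D) ℂ}
      {N : Matrix (C' × D') (C' × D') ℂ}, M.IsHermitian → N.IsHermitian →
      (withCatalyst M N).IsHermitian := fun hM hN => by
    ext x y
    simp [withCatalyst, ← hM.apply (x.1.1, x.2.1), ← hN.apply (x.1.2, x.2.2)]
  rw [h1]
  refine (traceNorm_add_le (hh hH hτ.1.isHermitian)
    ((hh hH' hρ'.1.isHermitian).submatrix _)).trans (add_le_add ?_ ?_)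
  · exact traceNorm_withCatalyst_le hH hτ
  · exact (IsLOCC.swapParts.traceNorm_le (hh hH' hρ'.1.isHermitian)).trans
      (traceNorm_withCatalyst_le hH' hρ')

end Calculus

/-! ### Tensor powers of a state. -/

section Copies

variable {A B : Type} [Fintype A] [DecidableEq A] [Fintype B] [DecidableEq B]
variable {A₂ B₂ : Type}

lemma relabel_symm_relabel (f : A ≃ A₂) (g : B ≃ B₂) (X : Matrix (A × B) (A × B) ℂ) :
    relabel f.symm g.symm (relabel f g X) = X := by
  ext x y; simp [relabel, Prod.map]

lemma copies_add (ρ : Matrix (A × B) (A × B) ℂ) (m n : ℕ) :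
    copies ρ (m + n) = relabel (Fin.appendEquiv m n) (Fin.appendEquiv m n)
      (withCatalyst (copies ρ m) (copies ρ n)) := by
  ext x y
  exact Fin.prod_univ_add _

lemma copies_one (ρ : Matrix (A × B) (A × B) ℂ) :
    copies ρ 1 = relabel (Equiv.funUnique (Fin 1) A).symm (Equiv.funUnique (Fin 1) B).symm ρ := by
  ext x y
  exact Fin.prod_univ_one _

lemma IsState.copies {ρ : Matrix (A × B) (A × B) ℂ} (hρ : IsState ρ) (n : ℕ) :
    IsState (copies ρ n) := by
  induction n with
  | zero =>
    have : LOCCRates.copies ρ 0 = 1 := by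
      ext x y
      rw [Subsingleton.elim x y, Matrix.one_apply_eq]
      exact Fin.prod_univ_zero _
    rw [this]
    exact ⟨Matrix.PosSemidef.one, by simp⟩
  | succ n ih =>
    rw [copies_add, copies_one]
    exact (IsLOCC.relabel _ _).isState (ih.withCatalyst ((IsLOCC.relabel _ _).isState hρ))

end Copies

/-! ### Approximate preparation of one state from copies of another. -/

section Preparation

variable {A B C D C' D' : Type} [Fintype A] [DecidableEq A] [Fintype B] [DecidableEq B]
  [Fintype C] [DecidableEq C] [Fintype D] [DecidableEq D]
  [Fintype C'] [DecidableEq C'] [Fintype D'] [DecidableEq D']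

/-- `τ` can be prepared by LOCC with arbitrary accuracy from finitely many copies of `ρ`. -/
def Preparable (ρ : Matrix (A × B) (A × B) ℂ) (τ : Matrix (C × D) (C × D) ℂ) : Prop :=
  ∀ ε : ℝ, 0 < ε → ∃ n : ℕ,
    ∃ Λ : Matrix ((Fin n → A) × (Fin n → B)) ((Fin n → A) × (Fin n → B)) ℂ →
      Matrix (C × D) (C × D) ℂ, IsLOCC Λ ∧ traceNorm (Λ (copies ρ n) - τ) < ε

lemma Preparable.map {ρ : Matrix (A × B) (A × B) ℂ} {τ : Matrix (C × D) (C × D) ℂ}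
    (h : Preparable ρ τ) (hρ : IsState ρ) (hτ : IsState τ)
    {Λ : Matrix (C × D) (C × D) ℂ → Matrix (C' × D') (C' × D') ℂ} (hΛ : IsLOCC Λ) :
    Preparable ρ (Λ τ) := fun ε hε => by
  obtain ⟨n, M, hM, hMτ⟩ := h ε hε
  refine ⟨n, _, hM.comp hΛ, ?_⟩
  rw [← hΛ.map_sub]
  exact (hΛ.traceNorm_le ((hM.isState (hρ.copies n)).1.isHermitian.sub hτ.1.isHermitian)).trans_lt
    hMτ

lemma Preparable.withCatalyst {ρ : Matrix (A × B) (A × B) ℂ} {τ : Matrix (C × D) (C × D) ℂ}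
    {τ' : Matrix (C' × D') (C' × D') ℂ} (h : Preparable ρ τ) (h' : Preparable ρ τ')
    (hρ : IsState ρ) (hτ : IsState τ) (hτ' : IsState τ') :
    Preparable ρ (withCatalyst τ τ') := fun ε hε => by
  obtain ⟨n, M, hM, hMτ⟩ := h (ε / 2) (half_pos hε)
  obtain ⟨n', M', hM', hMτ'⟩ := h' (ε / 2) (half_pos hε)
  obtain ⟨Λ, hΛ, hΛ'⟩ := hM.exists_prod hM'
  refine ⟨n + n', _, (IsLOCC.relabel (Fin.appendEquiv n n').symm (Fin.appendEquiv n n').symm).comp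
    hΛ, ?_⟩
  rw [copies_add, relabel_symm_relabel, hΛ']
  refine (traceNorm_withCatalyst_sub_le (hM.isState (hρ.copies n)) hτ (hM'.isState (hρ.copies n'))
    hτ').trans_lt ?_
  linarith

/-- All but one copy of a state can be discarded. -/
lemma exists_isLOCC_copies_eq {σ : Matrix (C × D) (C × D) ℂ} (hσ : IsState σ) (m : ℕ) :
    ∃ G : Matrix ((Fin (1 + m) → C) × (Fin (1 + m) → D)) ((Fin (1 + m) → C) × (Fin (1 + m) → D)) ℂ →
      Matrix (C × D) (C × D) ℂ, IsLOCC G ∧ G (copies σ (1 + m)) = σ := by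
  refine ⟨_, ((IsLOCC.relabel (Fin.appendEquiv (α := C) 1 m).symm
    (Fin.appendEquiv (α := D) 1 m).symm).comp IsLOCC.systemPart).comp
    (IsLOCC.relabel (Equiv.funUnique (Fin 1) C) (Equiv.funUnique (Fin 1) D)), ?_⟩
  rw [copies_add σ, relabel_symm_relabel, systemPart_withCatalyst _ (hσ.copies m).2, copies_one]
  exact relabel_symm_relabel _ _ _

lemma preparable_of_achievable {ρ : Matrix (A × B) (A × B) ℂ} {σ : Matrix (C × D) (C × D) ℂ}
    (hρ : IsState ρ) (hσ : IsState σ) {r : ℝ} (hr : 0 < r) (h : Achievable ρ σ r) :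
    Preparable ρ σ := fun ε hε => by
  -- With slack `δ = r` the rate condition reads `r < m/n + r`, which forces at least one output
  -- copy.
  obtain ⟨m, n, hn, Λ, hΛ, hΛε, hm⟩ := h ε hε r hr
  obtain ⟨m, rfl⟩ : ∃ k, m = 1 + k := by
    refine ⟨m - 1, ?_⟩
    rcases Nat.eq_zero_or_pos m with rfl | h
    · simp at hm
    · omega
  obtain ⟨G, hG, hGσ⟩ := exists_isLOCC_copies_eq hσ m
  refine ⟨n, _, hΛ.comp hG, ?_⟩
  conv_lhs => rw [← hGσ]
  rw [← hG.map_sub]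
  exact (hG.traceNorm_le ((hΛ.isState (hρ.copies n)).1.isHermitian.sub
    (hσ.copies (1 + m)).1.isHermitian)).trans_lt hΛε

end Preparation

/-! ### Teleportation with generalized Bell measurements. -/

section Teleportation

variable {C D C' D' : Type} [Fintype C] [DecidableEq C] [Fintype D] [DecidableEq D]
  [Fintype C'] [DecidableEq C'] [Fintype D'] [DecidableEq D']

/-- The operator `v vᴴ` of the vector `v` whose amplitudes are the entries of the matrix `V`. -/
def pureState (V : Matrix C D ℂ) : Matrix (C × D) (C × D) ℂ :=
  Matrix.vecMulVec (fun p => V p.1 p.2) (star fun p => V p.1 p.2)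

lemma pureState_apply (V : Matrix C D ℂ) (p q : C × D) :
    pureState V p q = V p.1 p.2 * star (V q.1 q.2) := rfl

/-- With vectors written as matrices, Alice's operators multiply from the left and Bob's,
transposed, from the right. Teleportation then becomes a cancellation of matrices. -/
lemma kronecker_conj_pureState (M : Matrix C' C ℂ) (N : Matrix D' D ℂ) (V : Matrix C D ℂ) :
    (M ⊗ₖ N) * pureState V * (M ⊗ₖ N)ᴴ = pureState (M * V * Nᵀ) := by
  have h : (M ⊗ₖ N) *ᵥ (fun p => V p.1 p.2) = fun p => (M * V * Nᵀ) p.1 p.2 := by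
    ext ⟨x, y⟩
    simp only [Matrix.mulVec, dotProduct, Matrix.mul_apply, Fintype.sum_prod_type,
      Matrix.kroneckerMap_apply, Matrix.transpose_apply, Finset.sum_mul]
    rw [Finset.sum_comm]
    exact Finset.sum_congr rfl fun _ _ => Finset.sum_congr rfl fun _ _ => by ring
  rw [pureState, pureState, Matrix.mul_vecMulVec, Matrix.vecMulVec_mul, ← h, Matrix.star_mulVec]

lemma withCatalyst_pureState (V : Matrix C D ℂ) (V' : Matrix C' D' ℂ) :
    withCatalyst (pureState V) (pureState V') = pureState (V ⊗ₖ V') := by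
  ext x y
  simp [withCatalyst, pureState_apply]; ring

/-- The hypothesis expresses maximal entanglement: Alice's reduced state `W * Wᴴ` is maximally
mixed. -/
lemma isState_pureState {X : Type} [Fintype X] [DecidableEq X] [Nonempty X] {W : Matrix X X ℂ}
    (hW : W * Wᴴ = (Fintype.card X : ℂ)⁻¹ • 1) : IsState (pureState W) := by
  refine ⟨Matrix.posSemidef_vecMulVec_self_star _, ?_⟩
  have h := congrArg Matrix.trace hW
  rw [Matrix.trace_smul, Matrix.trace_one, smul_eq_mul,
    inv_mul_cancel₀ (Nat.cast_ne_zero.2 Fintype.card_ne_zero)] at h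
  rw [← h]
  simp [Matrix.trace, pureState_apply, Matrix.mul_apply, Fintype.sum_prod_type]

section Weyl

variable {X : Type} [AddCommGroup X] [Fintype X] [DecidableEq X]

/-- The Heisenberg–Weyl operators of a finite abelian group. -/
def weyl (u : X × AddChar X ℂ) : Matrix X X ℂ :=
  fun x y => if x - u.1 = y then u.2 y else 0

lemma weyl_mul_conjTranspose (u : X × AddChar X ℂ) : weyl u * (weyl u)ᴴ = 1 := by
  ext x z
  rw [Matrix.mul_apply]
  simp only [weyl, Matrix.conjTranspose_apply, ite_mul, zero_mul, Finset.sum_ite_eq,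
    Finset.mem_univ, if_true, Matrix.one_apply]
  by_cases h : x = z
  · subst h
    simp [Complex.mul_conj, Complex.normSq_eq_norm_sq]
  · simp [h, Ne.symm h]

/-- Summing over characters kills the off-diagonal entries; summing over translations replaces each
diagonal entry by the trace. It normalizes the Bell measurement. -/
lemma sum_weyl_twirl (Y : Matrix X X ℂ) :
    ∑ u, (weyl u)ᴴ * Y * weyl u = ((Fintype.card X : ℂ) * Y.trace) • 1 := by
  ext a b
  have h1 : ∀ u : X × AddChar X ℂ, ((weyl u)ᴴ * Y * weyl u) a b =
      u.2 (b - a) * Y (a + u.1) (b + u.1) := by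
    intro u
    have h2 : ∀ x y : X, x - u.1 = y ↔ x = y + u.1 := fun x y => sub_eq_iff_eq_add
    simp only [Matrix.mul_apply, weyl, Matrix.conjTranspose_apply, h2, apply_ite, star_zero,
      ite_mul, zero_mul, mul_zero, Finset.sum_ite_eq', Finset.mem_univ, if_true]
    rw [sub_eq_add_neg, AddChar.map_add_eq_mul, AddChar.map_neg_eq_conj, starRingEnd_apply]
    ring
  rw [Matrix.sum_apply]
  simp_rw [h1, Fintype.sum_prod_type, ← Finset.sum_mul, AddChar.sum_apply_eq_ite]
  by_cases h : a = b
  · subst h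
    simp only [sub_self, if_true, ← Finset.mul_sum, Matrix.smul_apply, Matrix.one_apply_eq,
      smul_eq_mul, mul_one]
    exact congrArg _ (Equiv.sum_comp (Equiv.addLeft a) fun z => Y z z)
  · simp [h, sub_eq_zero, Ne.symm h]

end Weyl

open scoped Classical in
-- Bob's compression to the range of `e` is completed to a measurement: a basis vector outside the
-- range is detected and reset to `d₀`.
lemma sum_selector_option {Y : Type} [Fintype Y] [DecidableEq Y] (e : D ↪ Y) (d₀ : D) :
    ∑ l : Option Y, (l.elim (selector e) fun y =>
        if y ∈ Set.range e then 0 else Matrix.single d₀ y (1 : ℂ))ᴴ *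
      (l.elim (selector e) fun y =>
        if y ∈ Set.range e then 0 else Matrix.single d₀ y (1 : ℂ)) = 1 := by
  have h : ∀ y : Y, (if y ∈ Set.range e then 0 else Matrix.single d₀ y (1 : ℂ))ᴴ *
      (if y ∈ Set.range e then 0 else Matrix.single d₀ y (1 : ℂ)) =
      if y ∈ Set.range e then 0 else Matrix.single y y (1 : ℂ) := by
    intro y
    split_ifs <;> simp
  rw [Fintype.sum_option]
  simp only [Option.elim, h]
  ext x z
  rw [Matrix.add_apply, Matrix.sum_apply, Matrix.mul_apply]
  have h' : ∀ y : Y, (if y ∈ Set.range e then 0 else Matrix.single y y (1 : ℂ)) x z =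
      if y = x then (if x ∈ Set.range e then 0 else if x = z then 1 else 0) else 0 := by
    intro y
    by_cases hy : y = x
    · subst hy; by_cases hr : y ∈ Set.range e <;> simp [hr, Matrix.single_apply]
    · by_cases hr : y ∈ Set.range e <;> simp [hr, hy]
  simp only [h', Finset.sum_ite_eq', Finset.mem_univ, if_true, selector,
    Matrix.conjTranspose_apply, Matrix.submatrix_apply, Matrix.one_apply, id_eq]
  by_cases hr : x ∈ Set.range e
  · obtain ⟨d, rfl⟩ := hr
    rw [Finset.sum_eq_single d (fun b _ hb => by simp [hb]) (by simp)]
    simp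
  · have : ∀ d, e d ≠ x := fun d hd => hr ⟨d, hd⟩
    simp [hr, this]

lemma selector_mul_conjTranspose {Y : Type} [Fintype Y] [DecidableEq Y] (e : D ↪ Y) :
    selector e * (selector e)ᴴ = 1 := by
  ext x y
  simp [selector, Matrix.mul_apply, Matrix.one_apply]

/-- A maximally entangled state can be converted by one-way LOCC into any state for which the
dimension of Bob's system is not larger. -/
theorem exists_isLOCC_pureState_eq {X : Type} [AddCommGroup X] [Fintype X] [DecidableEq X]
    {W : Matrix X X ℂ} (hW : W * Wᴴ = (Fintype.card X : ℂ)⁻¹ • 1)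
    {τ : Matrix (C × D) (C × D) ℂ} (hτ : IsState τ) (hD : Fintype.card D ≤ Fintype.card X) :
    ∃ Λ : Matrix (X × X) (X × X) ℂ → Matrix (C × D) (C × D) ℂ,
      IsLOCC Λ ∧ Λ (pureState W) = τ := by
  classical
  obtain ⟨e⟩ := Function.Embedding.nonempty_of_card_le hD
  obtain ⟨⟨-, d₀⟩⟩ : Nonempty (C × D) := by
    by_contra h
    rw [not_nonempty_iff] at h
    simpa [Matrix.trace] using hτ.2
  obtain ⟨B, hB⟩ : ∃ B : Matrix (C × D) (C × D) ℂ, τ = Bᴴ * B := by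
    open scoped MatrixOrder in
    exact CStarAlgebra.nonneg_iff_eq_star_mul_self.1 hτ.1.nonneg
  set N : ℝ := (Fintype.card X : ℝ) with hN
  have hN0 : 0 < N := Nat.cast_pos.2 Fintype.card_pos
  have hsq : ((Real.sqrt N : ℝ) : ℂ) * ((Real.sqrt N : ℝ) : ℂ) = N := by
    rw [← Complex.ofReal_mul, Real.mul_self_sqrt hN0.le]
  have hs0 : ((Real.sqrt N : ℝ) : ℂ) ≠ 0 :=
    Complex.ofReal_ne_zero.2 (Real.sqrt_pos.2 hN0).ne'
  set s : ℂ := ((Real.sqrt N : ℝ) : ℂ) with hs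
  have hss : star s = s := Complex.conj_ofReal _
  have hNc : (Fintype.card X : ℂ) = s * s := by rw [hsq, hN]; simp
  rw [hNc] at hW
  -- The rows of `B` decompose `τ` into unnormalized pure states, one of which Alice's outcome
  -- selects.
  let V : C × D → Matrix C D ℂ := fun j c d => star (B j (c, d))
  have hV : ∑ j, pureState (V j) = τ := by
    ext p q
    rw [hB, Matrix.sum_apply, Matrix.mul_apply]
    refine Finset.sum_congr rfl fun j _ => ?_
    rw [pureState_apply]
    simp [V]
  -- Maximal entanglement makes these unitary, so Bob can invert them.
  let Q : X × AddChar X ℂ → Matrix X X ℂ := fun u => s • (weyl u * W)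
  have hQ : ∀ u, Q u * (Q u)ᴴ = 1 := fun u => by
    calc Q u * (Q u)ᴴ = (s * s) • (weyl u * (W * Wᴴ) * (weyl u)ᴴ) := by
          simp only [Q, Matrix.conjTranspose_smul, hss, Matrix.conjTranspose_mul, Matrix.mul_assoc,
            Matrix.smul_mul, Matrix.mul_smul, smul_smul]
      _ = 1 := by
          rw [hW, Matrix.mul_smul, Matrix.mul_one, Matrix.smul_mul, weyl_mul_conjTranspose,
            smul_smul, mul_inv_cancel₀ (mul_ne_zero hs0 hs0), one_smul]
  -- Alice's preparation of the state `V j` and her Bell measurement, with outcome `u`, merged into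
  -- one Kraus operator. The factor `s⁻¹` offsets the dimension in `sum_weyl_twirl`.
  let K : (C × D) × (X × AddChar X ℂ) → Matrix C X ℂ :=
    fun i => s⁻¹ • (V i.1 * selector e * weyl i.2)
  let S : Option X → Matrix D X ℂ := fun l =>
    l.elim (selector e) fun y => if y ∈ Set.range e then 0 else Matrix.single d₀ y (1 : ℂ)
  -- Bob undoes `Q u` and then compresses to `D`; the transpose anticipates
  -- `kronecker_conj_pureState`.
  let L : (C × D) × (X × AddChar X ℂ) → Option X → Matrix D X ℂ :=
    fun i l => S l * ((Q i.2)ᴴ)ᵀ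
  have hK : ∑ i, (K i)ᴴ * K i = 1 := by
    have h1 : ∀ i, (K i)ᴴ * K i = (s * s)⁻¹ • ((weyl i.2)ᴴ *
        ((V i.1 * selector e)ᴴ * (V i.1 * selector e)) * weyl i.2) := fun i => by
      simp only [K, Matrix.conjTranspose_smul, star_inv₀, hss, Matrix.conjTranspose_mul,
        Matrix.mul_assoc, Matrix.smul_mul, Matrix.mul_smul, smul_smul, mul_inv]
    have h2 : ∑ j, ((V j * selector e)ᴴ * (V j * selector e)).trace = 1 := by
      rw [← hτ.2, ← hV, Matrix.trace_sum]
      refine Finset.sum_congr rfl fun j _ => ?_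
      rw [Matrix.trace_mul_comm, Matrix.conjTranspose_mul, Matrix.mul_assoc,
        ← Matrix.mul_assoc (selector e), selector_mul_conjTranspose, Matrix.one_mul]
      simp [Matrix.trace, pureState_apply, Matrix.mul_apply, Fintype.sum_prod_type]
    simp_rw [h1, Fintype.sum_prod_type (f := fun i : (C × D) × (X × AddChar X ℂ) => _),
      ← Finset.smul_sum, sum_weyl_twirl, ← Finset.sum_smul, ← Finset.mul_sum, h2]
    rw [hNc, smul_smul, mul_one, inv_mul_cancel₀ (mul_ne_zero hs0 hs0), one_smul]
  have hL : ∀ i, ∑ l, (L i l)ᴴ * L i l = 1 := fun i => by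
    have h1 : ∀ l, (L i l)ᴴ * L i l = (Q i.2)ᵀ * ((S l)ᴴ * S l) * ((Q i.2)ᴴ)ᵀ := fun l => by
      have : (((Q i.2)ᴴ)ᵀ)ᴴ = (Q i.2)ᵀ := by ext; simp
      simp only [L, Matrix.conjTranspose_mul, Matrix.mul_assoc, this]
    simp_rw [h1]
    rw [← Finset.sum_mul, ← Finset.mul_sum, sum_selector_option e d₀, Matrix.mul_one,
      ← Matrix.transpose_mul, mul_eq_one_comm.1 (hQ i.2), Matrix.transpose_one]
  refine ⟨_, IsLOCC.oneWay K L hK hL, ?_⟩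
  have h1 : ∀ i l, K i * W * (L i l)ᵀ = (s * s)⁻¹ • (V i.1 * (selector e * (S l)ᵀ)) := by
    intro i l
    have h2 : K i * W = (s * s)⁻¹ • (V i.1 * selector e * Q i.2) := by
      simp only [K, Q, Matrix.mul_assoc, Matrix.smul_mul, Matrix.mul_smul, smul_smul]
      congr 1
      field_simp
    rw [h2, Matrix.transpose_mul, Matrix.transpose_transpose, Matrix.smul_mul, Matrix.mul_assoc,
      ← Matrix.mul_assoc (Q i.2), hQ, Matrix.one_mul, Matrix.mul_assoc]
  -- After the correction Bob's vector lies in the range of `e`, so the reset outcomes have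
  -- amplitude zero.
  have h2 : ∀ l, selector e * (S l)ᵀ = if l = none then 1 else 0 := by
    intro l
    cases l with
    | none =>
      have : (selector e)ᵀ = (selector e : Matrix D X ℂ)ᴴ := by
        ext x y; simp [selector, Matrix.one_apply, apply_ite]
      simp [S, this, selector_mul_conjTranspose]
    | some y =>
      by_cases hy : y ∈ Set.range e
      · simp only [S, Option.elim, if_pos hy]
        simp
      · ext d d'
        have : ∀ z, e z ≠ y := fun z hz => hy ⟨z, hz⟩
        simp only [S, Option.elim, if_neg hy, Matrix.mul_apply, selector, Matrix.submatrix_apply,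
          Matrix.one_apply, Matrix.transpose_apply, Matrix.single_apply, id_eq]
        exact Finset.sum_eq_zero fun j _ => by
          by_cases hj : y = j
          · simp [← hj, this]
          · simp [hj]
  have h3 : ∀ (c : ℂ) (M : Matrix C D ℂ), pureState (c • M) = (c * star c) • pureState M := by
    intro c M; ext p q
    simp [pureState_apply]; ring
  have h4 : pureState (0 : Matrix C D ℂ) = 0 := by ext; simp [pureState_apply]
  have h5 : ∀ i, ∑ l, (K i ⊗ₖ L i l) * pureState W * (K i ⊗ₖ L i l)ᴴ =
      ((s * s)⁻¹ * star (s * s)⁻¹) • pureState (V i.1) := fun i => by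
    simp only [kronecker_conj_pureState, h1, h2, h3]
    rw [Finset.sum_eq_single none (fun l _ hl => by simp [hl, h4]) (by simp)]
    simp
  simp only [h5]
  rw [Fintype.sum_prod_type_right]
  simp_rw [← Finset.smul_sum, hV]
  -- There are `|X|²` Bell outcomes `u`, each contributing `|X|⁻² • τ`.
  rw [Finset.sum_const, Finset.card_univ, Fintype.card_prod, AddChar.card_eq, ← Nat.cast_smul_eq_nsmul ℂ,
    smul_smul]
  push_cast
  rw [hNc, star_inv₀, star_mul', hss]
  convert one_smul ℂ τ
  field_simp

end Teleportation

/-! ### Preparing arbitrary states from distillable ones. -/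

section PreparableStates

variable {A B C D : Type} [Fintype A] [DecidableEq A] [Fintype B] [DecidableEq B]
  [Fintype C] [DecidableEq C] [Fintype D] [DecidableEq D]

/-- The amplitudes of the singlet, as a matrix. -/
noncomputable def singletMatrix : Matrix (Fin 2) (Fin 2) ℂ := fun x y => singletVec (x, y)

lemma singletMatrix_mul_conjTranspose :
    singletMatrix * singletMatrixᴴ = (Fintype.card (Fin 2) : ℂ)⁻¹ • 1 := by
  have h : ((Real.sqrt 2 : ℝ) : ℂ)⁻¹ * ((Real.sqrt 2 : ℝ) : ℂ)⁻¹ = 2⁻¹ := by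
    rw [← mul_inv, ← Complex.ofReal_mul, Real.mul_self_sqrt (by norm_num)]
    norm_num
  ext x y
  fin_cases x <;> fin_cases y <;>
    simp [Matrix.mul_apply, singletMatrix, singletVec, h, Complex.conj_ofReal]

lemma isState_singlet : IsState singlet :=
  isState_pureState singletMatrix_mul_conjTranspose

lemma kronecker_mul_conjTranspose_eq {X Y : Type} [Fintype X] [DecidableEq X] [Fintype Y]
    [DecidableEq Y] {W : Matrix X X ℂ} {W' : Matrix Y Y ℂ}
    (hW : W * Wᴴ = (Fintype.card X : ℂ)⁻¹ • 1) (hW' : W' * W'ᴴ = (Fintype.card Y : ℂ)⁻¹ • 1) :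
    (W ⊗ₖ W') * (W ⊗ₖ W')ᴴ = (Fintype.card (X × Y) : ℂ)⁻¹ • 1 := by
  rw [Matrix.conjTranspose_kronecker, ← Matrix.mul_kronecker_mul, hW, hW', Matrix.smul_kronecker,
    Matrix.kronecker_smul, Matrix.one_kronecker_one, smul_smul, Fintype.card_prod, Nat.cast_mul,
    mul_inv]

/-- Maximally entangled states of arbitrarily large dimension can be prepared from singlets. -/
lemma exists_preparable_pureState {ρ : Matrix (A × B) (A × B) ℂ} (hρ : IsState ρ)
    (h : Preparable ρ singlet) (N : ℕ) :
    ∃ (X : Type) (_ : AddCommGroup X) (_ : Fintype X) (_ : DecidableEq X) (W : Matrix X X ℂ),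
      W * Wᴴ = (Fintype.card X : ℂ)⁻¹ • 1 ∧ N < Fintype.card X ∧ Preparable ρ (pureState W) := by
  induction N with
  | zero =>
    exact ⟨Fin 2, inferInstance, inferInstance, inferInstance, singletMatrix,
      singletMatrix_mul_conjTranspose, by simp, h⟩
  | succ N ih =>
    obtain ⟨X, _, _, _, W, hW, hN, hP⟩ := ih
    -- One more singlet doubles the dimension.
    refine ⟨X × Fin 2, inferInstance, inferInstance, inferInstance, W ⊗ₖ singletMatrix,
      kronecker_mul_conjTranspose_eq hW singletMatrix_mul_conjTranspose, ?_, ?_⟩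
    · rw [Fintype.card_prod, Fintype.card_fin]; omega
    · rw [← withCatalyst_pureState]
      exact hP.withCatalyst h hρ (isState_pureState hW) isState_singlet

/-- Every state can be prepared from a distillable state. -/
theorem Distillable.preparable {ρ : Matrix (A × B) (A × B) ℂ} (hρ : IsState ρ)
    (h : Distillable ρ) {τ : Matrix (C × D) (C × D) ℂ} (hτ : IsState τ) : Preparable ρ τ := by
  obtain ⟨r, hr, hr0⟩ : ∃ r, Achievable ρ singlet r ∧ 0 < r := by
    rw [Distillable, rate, lt_iSup_iff] at h
    obtain ⟨r, h⟩ := h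
    obtain ⟨hr, h⟩ := lt_iSup_iff.1 h
    exact ⟨r, hr, by exact_mod_cast h⟩
  obtain ⟨X, _, _, _, W, hW, hN, hP⟩ := exists_preparable_pureState hρ
    (preparable_of_achievable hρ isState_singlet hr0 hr) (Fintype.card D)
  obtain ⟨Λ, hΛ, rfl⟩ := exists_isLOCC_pureState_eq hW hτ hN.le
  exact hP.map hρ (isState_pureState hW) hΛ

end PreparableStates

/-! ### Marginals as LOCC maps, and marginals of concatenated registers. -/

section Marginals

variable {A B : Type} [Fintype A] [DecidableEq A] [Fintype B] [DecidableEq B]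

/-- Exhibits a marginal as a relabelling followed by a partial trace, so that it inherits the
properties of LOCC maps. -/
lemma marginal_eq_systemPart {m : ℕ}
    (μ : Matrix ((Fin m → A) × (Fin m → B)) ((Fin m → A) × (Fin m → B)) ℂ) (i : Fin m) :
    marginal μ i = systemPart (relabel (Equiv.funSplitAt i A) (Equiv.funSplitAt i B) μ) := by
  have h : ∀ {T : Type} [DecidableEq T] (t : T) (c : {j // j ≠ i} → T) (s : T),
      Function.update ((Equiv.funSplitAt i T).symm (t, c)) i s =
        (Equiv.funSplitAt i T).symm (s, c) := fun t c s => by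
    ext j
    by_cases hj : j = i
    · subst hj; simp
    · simp [hj]
  have h' : ∀ {T : Type} [DecidableEq T] (t : T) (c : {j // j ≠ i} → T),
      (Equiv.funSplitAt i T).symm (t, c) i = t := fun t c => by simp
  ext x y
  rw [marginal, ← (Equiv.funSplitAt i A).symm.sum_comp, Fintype.sum_prod_type]
  simp_rw [← (Equiv.funSplitAt i B).symm.sum_comp, Fintype.sum_prod_type, h, h', ite_and]
  simp [systemPart, relabel, -Equiv.funSplitAt_symm_apply]

lemma IsLOCC.marginal {m : ℕ} (i : Fin m) :
    IsLOCC (fun μ : Matrix ((Fin m → A) × (Fin m → B)) ((Fin m → A) × (Fin m → B)) ℂ =>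
      marginal μ i) := by
  simp only [marginal_eq_systemPart]
  exact (IsLOCC.relabel _ _).comp IsLOCC.systemPart

variable {m n : ℕ}
  (X : Matrix (((Fin m → A) × (Fin n → A)) × ((Fin m → B) × (Fin n → B)))
    (((Fin m → A) × (Fin n → A)) × ((Fin m → B) × (Fin n → B))) ℂ)

lemma marginal_relabel_append_castAdd (i : Fin m) :
    marginal (relabel (Fin.appendEquiv m n) (Fin.appendEquiv m n) X) (Fin.castAdd n i) =
      marginal (systemPart X) i := by
  have h : ∀ {T : Type} [DecidableEq T] (u : Fin m → T) (v : Fin n → T) (s : T),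
      (Fin.appendEquiv m n).symm (Function.update (Fin.appendEquiv m n (u, v))
        (Fin.castAdd n i) s) = (Function.update u i s, v) := fun u v s => by
    rw [Equiv.symm_apply_eq]
    ext j
    refine Fin.addCases (fun j => ?_) (fun j => ?_) j
    · by_cases hj : j = i
      · subst hj; simp [Fin.appendEquiv]
      · simp [Fin.appendEquiv, Function.update_of_ne, hj]
    · rw [Function.update_of_ne (by simp [Fin.ext_iff]; omega)]
      simp [Fin.appendEquiv]
  have h' : ∀ {T : Type} (u : Fin m → T) (v : Fin n → T),
      Fin.appendEquiv m n (u, v) (Fin.castAdd n i) = u i := fun u v => by simp [Fin.appendEquiv]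
  ext x y
  simp only [marginal, relabel, Matrix.submatrix_apply, Prod.map]
  rw [← (Fin.appendEquiv m n).sum_comp]
  simp_rw [← (Fin.appendEquiv (α := B) m n).sum_comp, Fintype.sum_prod_type, h, h',
    Equiv.symm_apply_apply]
  refine Finset.sum_congr rfl fun u _ => ?_
  rw [Finset.sum_comm]
  refine Finset.sum_congr rfl fun v _ => ?_
  by_cases hc : u i = x.1 ∧ v i = x.2 <;> simp [hc, systemPart]

lemma marginal_relabel_append_natAdd (i : Fin n) :
    marginal (relabel (Fin.appendEquiv m n) (Fin.appendEquiv m n) X) (Fin.natAdd m i) =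
      marginal (catalystPart X) i := by
  have h : ∀ {T : Type} [DecidableEq T] (u : Fin m → T) (v : Fin n → T) (s : T),
      (Fin.appendEquiv m n).symm (Function.update (Fin.appendEquiv m n (u, v))
        (Fin.natAdd m i) s) = (u, Function.update v i s) := fun u v s => by
    rw [Equiv.symm_apply_eq]
    ext j
    refine Fin.addCases (fun j => ?_) (fun j => ?_) j
    · rw [Function.update_of_ne (by simp [Fin.ext_iff]; omega)]
      simp [Fin.appendEquiv]
    · by_cases hj : j = i
      · subst hj; simp [Fin.appendEquiv]
      · simp [Fin.appendEquiv, Function.update_of_ne, hj]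
  have h' : ∀ {T : Type} (u : Fin m → T) (v : Fin n → T),
      Fin.appendEquiv m n (u, v) (Fin.natAdd m i) = v i := fun u v => by simp [Fin.appendEquiv]
  ext x y
  simp only [marginal, relabel, Matrix.submatrix_apply, Prod.map]
  rw [← (Fin.appendEquiv m n).sum_comp]
  simp_rw [← (Fin.appendEquiv (α := B) m n).sum_comp, Fintype.sum_prod_type_right, h, h',
    Equiv.symm_apply_apply]
  refine Finset.sum_congr rfl fun u _ => ?_
  rw [Finset.sum_comm]
  refine Finset.sum_congr rfl fun v _ => ?_
  by_cases hc : u i = x.1 ∧ v i = x.2 <;> simp [hc, catalystPart]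

end Marginals

/-! ### Reuse of the catalyst. -/

section Iteration

variable {A₁ B₁ A₂ B₂ S₁ T₁ S₂ T₂ C D : Type}
  [Fintype A₁] [DecidableEq A₁] [Fintype B₁] [DecidableEq B₁]
  [Fintype A₂] [DecidableEq A₂] [Fintype B₂] [DecidableEq B₂]
  [Fintype S₁] [DecidableEq S₁] [Fintype T₁] [DecidableEq T₁]
  [Fintype S₂] [DecidableEq S₂] [Fintype T₂] [DecidableEq T₂]
  [Fintype C] [DecidableEq C] [Fintype D] [DecidableEq D]

/-- Interchanges the outer factors of a triple product. -/
def swapOuterEquiv (P Q R : Type) : (P × Q) × R ≃ (R × Q) × P where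
  toFun x := ((x.2, x.1.2), x.1.1)
  invFun x := ((x.2, x.1.2), x.1.1)

/-- Interchanges the last two factors of a triple product. -/
def rightCommEquiv (P Q R : Type) : (P × Q) × R ≃ (P × R) × Q where
  toFun x := ((x.1.1, x.2), x.1.2)
  invFun x := ((x.1.1, x.2), x.1.2)

/-- Cyclic permutation of the factors of a triple product. -/
def rotateEquiv (P Q R : Type) : (P × Q) × R ≃ (R × P) × Q where
  toFun x := ((x.2, x.1.1), x.1.2)
  invFun x := ((x.1.2, x.2), x.1.1)

lemma sum_comm_middle {P Q R S : Type} [Fintype P] [Fintype Q] [Fintype R] [Fintype S]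
    (f : P → Q → R → S → ℂ) :
    ∑ p, ∑ q, ∑ r, ∑ s, f p q r s = ∑ p, ∑ r, ∑ q, ∑ s, f p q r s :=
  Finset.sum_congr rfl fun _ _ => Finset.sum_comm

lemma sum_comm_pairs {P Q R S : Type} [Fintype P] [Fintype Q] [Fintype R] [Fintype S]
    (f : P → Q → R → S → ℂ) :
    ∑ p, ∑ q, ∑ r, ∑ s, f p q r s = ∑ r, ∑ s, ∑ p, ∑ q, f p q r s := by
  have := Finset.sum_comm (s := (Finset.univ : Finset (P × Q)))
    (t := (Finset.univ : Finset (R × S))) (f := fun x y => f x.1 x.2 y.1 y.2)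
  simpa only [Fintype.sum_prod_type] using this

/-- Two catalytic protocols can be run one after the other with the same catalyst. -/
theorem exists_isLOCC_sequential
    {Λ₁ : Matrix ((A₁ × C) × (B₁ × D)) ((A₁ × C) × (B₁ × D)) ℂ →
      Matrix ((S₁ × C) × (T₁ × D)) ((S₁ × C) × (T₁ × D)) ℂ} (h₁ : IsLOCC Λ₁)
    {Λ₂ : Matrix ((A₂ × C) × (B₂ × D)) ((A₂ × C) × (B₂ × D)) ℂ →
      Matrix ((S₂ × C) × (T₂ × D)) ((S₂ × C) × (T₂ × D)) ℂ} (h₂ : IsLOCC Λ₂)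
    {ρ₁ : Matrix (A₁ × B₁) (A₁ × B₁) ℂ} {ρ₂ : Matrix (A₂ × B₂) (A₂ × B₂) ℂ}
    {τ : Matrix (C × D) (C × D) ℂ} (hρ₂ : ρ₂.trace = 1)
    (hτ₁ : catalystPart (Λ₁ (withCatalyst ρ₁ τ)) = τ) :
    ∃ Λ : Matrix (((A₁ × A₂) × C) × ((B₁ × B₂) × D)) (((A₁ × A₂) × C) × ((B₁ × B₂) × D)) ℂ →
        Matrix (((S₁ × S₂) × C) × ((T₁ × T₂) × D)) (((S₁ × S₂) × C) × ((T₁ × T₂) × D)) ℂ,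
      IsLOCC Λ ∧
      catalystPart (Λ (withCatalyst (withCatalyst ρ₁ ρ₂) τ)) =
        catalystPart (Λ₂ (withCatalyst ρ₂ τ)) ∧
      systemPart (systemPart (Λ (withCatalyst (withCatalyst ρ₁ ρ₂) τ))) =
        systemPart (Λ₁ (withCatalyst ρ₁ τ)) ∧
      catalystPart (systemPart (Λ (withCatalyst (withCatalyst ρ₁ ρ₂) τ))) =
        systemPart (Λ₂ (withCatalyst ρ₂ τ)) := by
  have hin : relabel (rightCommEquiv A₁ A₂ C) (rightCommEquiv B₁ B₂ D)
      (withCatalyst (withCatalyst ρ₁ ρ₂) τ) = withCatalyst (withCatalyst ρ₁ τ) ρ₂ := by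
    ext x y
    simp only [relabel, rightCommEquiv, withCatalyst, Matrix.submatrix_apply, Prod.map,
      Equiv.coe_fn_symm_mk]
    ring
  refine ⟨_, ((((IsLOCC.relabel (rightCommEquiv A₁ A₂ C) (rightCommEquiv B₁ B₂ D)).comp
    (h₁.withIdle A₂ B₂)).comp
    (IsLOCC.relabel (swapOuterEquiv S₁ C A₂) (swapOuterEquiv T₁ D B₂))).comp (h₂.withIdle S₁ T₁)).comp
    (IsLOCC.relabel (rotateEquiv S₂ C S₁) (rotateEquiv T₂ D T₁)), ?_⟩
  rw [hin, withIdle_withCatalyst h₁]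
  set μ := Λ₁ (withCatalyst ρ₁ τ)
  set Y := relabel (swapOuterEquiv S₁ C A₂) (swapOuterEquiv T₁ D B₂) (withCatalyst μ ρ₂) with hY
  -- The crux: once the first output is traced out, the second run finds its exact product input,
  -- because the catalyst's reduced state is exactly `τ`.
  have hYs : systemPart Y = withCatalyst ρ₂ τ := by
    rw [← hτ₁]
    ext x y
    simp only [hY, systemPart, relabel, swapOuterEquiv, withCatalyst, catalystPart,
      Matrix.submatrix_apply, Prod.map, Equiv.coe_fn_symm_mk, Finset.mul_sum]
    exact Finset.sum_congr rfl fun _ _ => Finset.sum_congr rfl fun _ _ => mul_comm _ _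
  -- The first output is idle during the second run, so its reduced state survives.
  have hYc : catalystPart Y = systemPart μ := by
    have : catalystPart Y = systemPart (systemPart (withCatalyst μ ρ₂)) := by
      ext x y
      simp only [hY, systemPart, relabel, swapOuterEquiv, catalystPart,
        Matrix.submatrix_apply, Prod.map, Equiv.coe_fn_symm_mk, Fintype.sum_prod_type]
      rw [sum_comm_middle, sum_comm_pairs]
    rw [this, systemPart_withCatalyst _ hρ₂]
  set Z := withIdle S₁ T₁ Λ₂ Y
  have hZs : systemPart Z = Λ₂ (withCatalyst ρ₂ τ) := by rw [systemPart_withIdle h₂, hYs]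
  have hZc : catalystPart Z = systemPart μ := by rw [catalystPart_withIdle h₂, hYc]
  rw [← hZs, ← hZc]
  refine ⟨?_, ?_, ?_⟩ <;> ext x y <;>
    simp only [systemPart, relabel, rotateEquiv, catalystPart,
        Matrix.submatrix_apply, Prod.map, Equiv.coe_fn_symm_mk, Fintype.sum_prod_type]
  · rw [sum_comm_middle, sum_comm_pairs]
  · rw [sum_comm_middle]
  · rw [sum_comm_pairs]

end Iteration

/-! ### Repeated runs and comparison of the two rates. -/

section Main

variable {A B A' B' : Type} [Fintype A] [DecidableEq A] [Fintype B] [DecidableEq B]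
  [Fintype A'] [DecidableEq A'] [Fintype B'] [DecidableEq B']

lemma relabel_withCatalyst {A₂ B₂ C D : Type} (f : A ≃ A₂) (g : B ≃ B₂)
    (ρ : Matrix (A × B) (A × B) ℂ) (τ : Matrix (C × D) (C × D) ℂ) :
    relabel (f.prodCongr (Equiv.refl C)) (g.prodCongr (Equiv.refl D)) (withCatalyst ρ τ) =
      withCatalyst (relabel f g ρ) τ := rfl

lemma systemPart_relabel {S T S₂ T₂ C D : Type} [Fintype C] [Fintype D] (f : S ≃ S₂) (g : T ≃ T₂)
    (X : Matrix ((S × C) × (T × D)) ((S × C) × (T × D)) ℂ) :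
    systemPart (relabel (f.prodCongr (Equiv.refl C)) (g.prodCongr (Equiv.refl D)) X) =
      relabel f g (systemPart X) := rfl

lemma catalystPart_relabel {S T S₂ T₂ C D : Type} [Fintype S] [Fintype T] [Fintype S₂]
    [Fintype T₂] (f : S ≃ S₂) (g : T ≃ T₂)
    (X : Matrix ((S × C) × (T × D)) ((S × C) × (T × D)) ℂ) :
    catalystPart (relabel (f.prodCongr (Equiv.refl C)) (g.prodCongr (Equiv.refl D)) X) =
      catalystPart X := by
  ext x y
  simp only [catalystPart]
  rw [← f.sum_comp]
  simp_rw [← g.sum_comp]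
  simp [relabel]

/-- A catalytic protocol can be run repeatedly on fresh copies with the same catalyst. -/
theorem exists_isLOCC_iterate {C D : Type} [Fintype C] [DecidableEq C] [Fintype D] [DecidableEq D]
    {ρ : Matrix (A × B) (A × B) ℂ} (hρ : IsState ρ) {τ : Matrix (C × D) (C × D) ℂ} {n m : ℕ}
    {Λ : Matrix (((Fin n → A) × C) × ((Fin n → B) × D)) (((Fin n → A) × C) × ((Fin n → B) × D)) ℂ →
      Matrix (((Fin m → A') × C) × ((Fin m → B') × D))
        (((Fin m → A') × C) × ((Fin m → B') × D)) ℂ} (hΛ : IsLOCC Λ)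
    (hτ : catalystPart (Λ (withCatalyst (copies ρ n) τ)) = τ) (k : ℕ) :
    ∃ M : Matrix (((Fin (n * k) → A) × C) × ((Fin (n * k) → B) × D))
          (((Fin (n * k) → A) × C) × ((Fin (n * k) → B) × D)) ℂ →
        Matrix (((Fin (m * k) → A') × C) × ((Fin (m * k) → B') × D))
          (((Fin (m * k) → A') × C) × ((Fin (m * k) → B') × D)) ℂ,
      IsLOCC M ∧ catalystPart (M (withCatalyst (copies ρ (n * k)) τ)) = τ ∧
      ∀ i, ∃ j, marginal (systemPart (M (withCatalyst (copies ρ (n * k)) τ))) i =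
        marginal (systemPart (Λ (withCatalyst (copies ρ n) τ))) j := by
  induction k with
  | zero =>
    -- With no runs, input and output registers are one-dimensional, and a relabelling identifies
    -- them.
    have hu : ∀ (n m : ℕ) (S T : Type), Nonempty ((Fin (n * 0) → S) ≃ (Fin (m * 0) → T)) :=
      fun n m S T => by
        have : ∀ a, IsEmpty (Fin (a * 0)) := fun a => (inferInstance : IsEmpty (Fin 0))
        exact ⟨Equiv.ofUnique _ _⟩
    obtain ⟨f⟩ := hu n m A A'
    obtain ⟨g⟩ := hu n m B B'
    refine ⟨_, IsLOCC.relabel (f.prodCongr (Equiv.refl C)) (g.prodCongr (Equiv.refl D)), ?_,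
      fun i => (Nat.not_lt_zero _ i.2).elim⟩
    rw [relabel_withCatalyst]
    exact catalystPart_withCatalyst ((IsLOCC.relabel f g).isState (hρ.copies _)).2 τ
  | succ k ih =>
    obtain ⟨M, hM, hMτ, hMm⟩ := ih
    obtain ⟨M', hM', h1, h2, h3⟩ :=
      exists_isLOCC_sequential hM hΛ (hρ.copies n).2 hMτ
    let a (S : Type) (p q : ℕ) : (Fin p → S) × (Fin q → S) ≃ (Fin (p + q) → S) :=
      Fin.appendEquiv p q
    have hin : relabel ((a A (n * k) n).symm.prodCongr (Equiv.refl C))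
        ((a B (n * k) n).symm.prodCongr (Equiv.refl D))
        (withCatalyst (copies ρ (n * k + n)) τ) =
        withCatalyst (withCatalyst (copies ρ (n * k)) (copies ρ n)) τ := by
      rw [relabel_withCatalyst, copies_add, relabel_symm_relabel]
    refine ⟨_, ((IsLOCC.relabel ((a A (n * k) n).symm.prodCongr (Equiv.refl C))
      ((a B (n * k) n).symm.prodCongr (Equiv.refl D))).comp hM').comp
      (IsLOCC.relabel ((a A' (m * k) m).prodCongr (Equiv.refl C))
        ((a B' (m * k) m).prodCongr (Equiv.refl D))), ?_, ?_⟩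
    -- `n * (k + 1)` and `n * k + n` agree only by unfolding.
    · erw [hin]
      rw [catalystPart_relabel, h1, hτ]
    · erw [hin]
      rw [systemPart_relabel]
      intro i
      refine Fin.addCases (m := m * k) (n := m) (fun i => ?_) (fun i => ?_) i
      · obtain ⟨j, hj⟩ := hMm i
        exact ⟨j, by rw [marginal_relabel_append_castAdd, h2, hj]⟩
      · exact ⟨i, by rw [marginal_relabel_append_natAdd, h3]⟩

/-- The `n₀` copies spent on the catalyst are a fixed overhead, negligible over many runs. -/
lemma exists_lt_mul_div_add {r δ : ℝ} {m n : ℕ} (n₀ : ℕ) (hn : 0 < n) (hδ : 0 < δ)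
    (h : r < (m : ℝ) / n + δ / 2) :
    ∃ k : ℕ, 0 < n * k + n₀ ∧ r < ((m * k : ℕ) : ℝ) / ((n * k + n₀ : ℕ) : ℝ) + δ := by
  -- The loss in rate is `m n₀ / (n (n k + n₀)) ≤ m n₀ / k`, which this `k` pushes below `δ / 2`.
  obtain ⟨k, hk⟩ := exists_nat_gt (2 * (m * n₀) / δ)
  have hk0 : (0 : ℝ) < k := lt_of_le_of_lt (by positivity) hk
  have hk1 : 0 < k := by exact_mod_cast hk0
  have hpos : 0 < n * k + n₀ := Nat.add_pos_left (Nat.mul_pos hn hk1) _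
  refine ⟨k, hpos, ?_⟩
  have hn1 : (1 : ℝ) ≤ n := by exact_mod_cast hn
  have hp : (0 : ℝ) < n * k + n₀ := by exact_mod_cast hpos
  have h1 : (m : ℝ) / n - m * k / (n * k + n₀) = m * n₀ / (n * (n * k + n₀)) := by
    field_simp
    ring
  have h2 : (m * n₀ : ℝ) / (n * (n * k + n₀)) < δ / 2 := by
    rw [div_lt_iff₀ (by positivity)]
    rw [div_lt_iff₀ hδ] at hk
    have h3 : (k : ℝ) ≤ n * (n * k + n₀) := by
      have : (k : ℝ) ≤ n * k + n₀ := by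
        nlinarith [mul_le_mul_of_nonneg_right hn1 hk0.le, Nat.cast_nonneg (α := ℝ) n₀]
      nlinarith [mul_le_mul_of_nonneg_right hn1 hp.le]
    nlinarith [mul_le_mul_of_nonneg_left h3 hδ.le]
  push_cast
  linarith

theorem MarginalAchievable.marginalCatalyticAchievable {ρ : Matrix (A × B) (A × B) ℂ}
    (hρ : IsState ρ) {σ : Matrix (A' × B') (A' × B') ℂ} {r : ℝ} (h : MarginalAchievable ρ σ r) :
    MarginalCatalyticAchievable ρ σ r := fun ε hε δ hδ => by
  obtain ⟨m, n, hn, Λ, hΛ, hm, hr⟩ := h ε hε δ hδ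
  have hτ : IsState (1 : Matrix (Fin 1 × Fin 1) (Fin 1 × Fin 1) ℂ) :=
    ⟨Matrix.PosSemidef.one, by simp⟩
  refine ⟨m, n, hn, 1, 1, 1, hτ, _, hΛ.withIdle _ _, ?_, ?_, hr⟩
  · rwa [systemPart_withIdle hΛ, systemPart_withCatalyst _ hτ.2]
  · rw [catalystPart_withIdle hΛ, catalystPart_withCatalyst (hρ.copies n).2]

theorem MarginalCatalyticAchievable.marginalAchievable {ρ : Matrix (A × B) (A × B) ℂ}
    (hρ : IsState ρ) (hd : Distillable ρ) {σ : Matrix (A' × B') (A' × B') ℂ} (hσ : IsState σ)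
    {r : ℝ} (h : MarginalCatalyticAchievable ρ σ r) : MarginalAchievable ρ σ r :=
  fun ε hε δ hδ => by
  obtain ⟨m, n, hn, c, d, τ, hτ, Λ, hΛ, hm, hcat, hr⟩ := h (ε / 2) (half_pos hε) (δ / 2)
    (half_pos hδ)
  -- The accuracy, and hence `n₀`, is fixed before the number `k` of runs is chosen.
  obtain ⟨n₀, P, hP, hPτ⟩ := hd.preparable hρ hτ (ε / 2) (half_pos hε)
  obtain ⟨k, hk, hkr⟩ := exists_lt_mul_div_add n₀ hn hδ hr
  obtain ⟨M, hM, -, hMm⟩ := exists_isLOCC_iterate hρ hΛ hcat k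
  obtain ⟨G, hG, hGP⟩ := (IsLOCC.done (A' := Fin (n * k) → A) (B' := Fin (n * k) → B)).exists_prod hP
  refine ⟨m * k, n * k + n₀, hk, _, (((IsLOCC.relabel (Fin.appendEquiv (n * k) n₀).symm
    (Fin.appendEquiv (n * k) n₀).symm).comp hG).comp hM).comp IsLOCC.systemPart, fun i => ?_, hkr⟩
  rw [copies_add, relabel_symm_relabel, hGP]
  -- All `k` runs and the final marginal form a single LOCC map, so the imperfect catalyst costs at
  -- most `ε / 2` per marginal, whatever `k` is.
  have hF := (hM.comp IsLOCC.systemPart).comp (IsLOCC.marginal i)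
  have hρk := hρ.copies (n * k)
  have hτ' := hP.isState (hρ.copies n₀)
  have hX := hρk.withCatalyst hτ'
  have hY := hρk.withCatalyst hτ
  obtain ⟨j, hj⟩ := hMm i
  rw [← sub_add_sub_cancel _ (marginal (systemPart (M (withCatalyst (copies ρ (n * k)) τ))) i) σ]
  refine (traceNorm_add_le ((hF.isState hX).1.isHermitian.sub (hF.isState hY).1.isHermitian)
    ((hF.isState hY).1.isHermitian.sub hσ.1.isHermitian)).trans_lt ?_
  have h1 := hF.traceNorm_le (hX.1.isHermitian.sub hY.1.isHermitian)
  rw [hF.map_sub] at h1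
  have h2 := h1.trans (traceNorm_withCatalyst_sub_le hρk hρk hτ' hτ)
  rw [sub_self, traceNorm_zero, zero_add] at h2
  rw [hj] at h2 ⊢
  have h3 := hm j
  linarith

end Main

end LOCCRates

theorem mainTheorem3 {A B A' B' : Type} [Fintype A] [DecidableEq A] [Fintype B] [DecidableEq B]
    [Fintype A'] [DecidableEq A'] [Fintype B'] [DecidableEq B']
    (ρ : Matrix (A × B) (A × B) ℂ) (hρ : LOCCRates.IsState ρ)
    (σ : Matrix (A' × B') (A' × B') ℂ) (hσ : LOCCRates.IsState σ)
    (hρd : LOCCRates.Distillable ρ) (hσd : LOCCRates.Distillable σ) :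
    LOCCRates.marginalCatalyticRate ρ σ = LOCCRates.marginalRate ρ σ := by
  have h : ∀ r, LOCCRates.MarginalCatalyticAchievable ρ σ r ↔ LOCCRates.MarginalAchievable ρ σ r :=
    fun r => ⟨fun h => h.marginalAchievable hρ hρd hσ, fun h => h.marginalCatalyticAchievable hρ⟩
  simp only [LOCCRates.marginalCatalyticRate, LOCCRates.marginalRate, h]
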